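/- Let $\mathcal P$ be a countable set with a map $N:\mathcal P\to\mathbb Z_{>1}$, let $\mathcal M$ be the free abelian monoid on $\mathcal P$, whose elements are written $\mathfrak m=\sum_{\mathfrak p}n_{\mathfrak p}(\mathfrak m)\,\mathfrak p$ with $n_{\mathfrak p}(\mathfrak m)\in\mathbb Z_{\ge 0}$, almost all zero, and extend $N$ to $\mathcal M$ by $N(\mathfrak m)=\prod_{\mathfrak p}N(\mathfrak p)^{n_{\mathfrak p}(\mathfrak m)}$. Let $X\subseteq\mathbb Q$ contain $N(\mathcal M)$ and be closed under quotients: if $x_1,x_2\in X$ and $x_2\neq 0$, then $x_1/x_2\in X$ (for example $X=\mathbb Q$, or $X=\{q^z: z\in\mathbb Z\}$ with an integer $q\ge 2$ when all norms are powers of $q$). Assume that there are $\kappa>0$ and $0\le\theta<1$ such that, as $x\to\infty$ with $x\in X$, $$|\{\mathfrak m\in\mathcal M: N(\mathfrak m)\le x\}|=\kappa x+O(x^{\theta})$$ (in particular, these sets are finite). Let $k\ge 1$ be an integer and let $\mathcal N_k(x)$ be the set of $k$-full elements of norm at most $x$, that is, of those $\mathfrak m\in\mathcal M$ with $N(\mathfrak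 m)\le x$ such that $n_{\mathfrak p}(\mathfrak m)\ge k$ whenever $n_{\mathfrak p}(\mathfrak m)\ge 1$ (so every element is $1$-full). Put $$\Omega(\mathfrak m)=\sum_{\mathfrak p}n_{\mathfrak p}(\mathfrak m),\qquad d(\mathfrak m)=|\{\mathfrak d\in\mathcal M: n_{\mathfrak p}(\mathfrak d)\le n_{\mathfrak p}(\mathfrak m)\text{ for all }\mathfrak p\}|,$$ $$\omega_T(\mathfrak m)=|\{\mathfrak p: n_{\mathfrak p}(\mathfrak m)\text{ odd}\}|-|\{\mathfrak p: n_{\mathfrak p}(\mathfrak m)\ge 1\text{ even}\}|.$$ Let $g$ be any one of the three functions $$g(\mathfrak m)=\frac1k\,\Omega(\mathfrak m),\qquad g(\mathfrak m)=\frac{\log d(\mathfrak m)}{\log(k+1)},\qquad g(\mathfrak m)=(-1)^{k-1}\omega_T(\mathfrak m).$$ Then for every $a\in\mathbb R$, $$\lim_{\substack{x\to\infty\\ x\in X}}\frac{1}{|\mathcal N_k(x)|}\left|\left\{\mathfrak m\in\mathcal N_k(x): N(\mathfrak m)\ge 3,\ \frac{g(\mathfrak m)-\log\log N(\mathfrak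 m)}{\sqrt{\log\log N(\mathfrak m)}}\le a\right\}\right|=\frac1{\sqrt{2\pi}}\int_{-\infty}^{a}e^{-u^2/2}\,du .$$ -/

import Mathlib

open Filter Asymptotics

noncomputable section

namespace ErdosKacMonoid

variable {P : Type*}

/-- The free abelian monoid on the set `P` of prime elements; `m p` is the multiplicity of `p`. -/
abbrev FreeAbMonoid (P : Type*) : Type _ := P →₀ ℕ

/-- The multiplicative extension of a norm map on prime elements to the free abelian monoid. -/
def elementNorm (N : P → ℕ) (m : FreeAbMonoid P) : ℕ := m.prod fun p n => N p ^ n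

/-- The elements of the subset `S` whose norm is at most `x`. -/
def upTo (N : P → ℕ) (S : Set (FreeAbMonoid P)) (x : ℚ) : Set (FreeAbMonoid P) :=
  {m | m ∈ S ∧ (elementNorm N m : ℚ) ≤ x}

/-- The filter `x → ∞` with `x` restricted to `X`. -/
def atTopIn (X : Set ℚ) : Filter ℚ := atTop ⊓ 𝓟 X

/-- The set `X` contains all norms and is closed under quotients. -/
def IsNormRange (N : P → ℕ) (X : Set ℚ) : Prop :=
  (∀ m : FreeAbMonoid P, (elementNorm N m : ℚ) ∈ X) ∧ ∀ x₁ ∈ X, ∀ x₂ ∈ X, x₂ ≠ 0 → x₁ / x₂ ∈ X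

/-- The number of elements of norm at most `x` is (finite and) `κ x + O(x ^ θ)` as `x → ∞` in `X`,
for some `κ > 0` and `0 ≤ θ < 1`. -/
def ConditionStar (N : P → ℕ) (X : Set ℚ) : Prop :=
  (∀ᶠ x in atTopIn X, (upTo N Set.univ x).Finite) ∧
  ∃ κ θ : ℝ, 0 < κ ∧ 0 ≤ θ ∧ θ < 1 ∧
    (fun x : ℚ => ((upTo N Set.univ x).ncard : ℝ) - κ * (x : ℝ))
      =O[atTopIn X] fun x : ℚ => (x : ℝ) ^ θ

/-- The set of `k`-full elements: every prime element that occurs has multiplicity at least `k`. -/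
def fullElements (P : Type*) (k : ℕ) : Set (FreeAbMonoid P) :=
  {m | ∀ p, 1 ≤ m p → k ≤ m p}

/-- Number of prime elements of `m`, counted with multiplicity. -/
def bigOmega (m : FreeAbMonoid P) : ℕ := ∑ p ∈ m.support, m p

/-- Number of divisors of `m`. -/
def numDivisors (m : FreeAbMonoid P) : ℕ := {d : FreeAbMonoid P | ∀ p, d p ≤ m p}.ncard

/-- Number of prime elements occurring in `m` with odd multiplicity minus the number of those
occurring with (positive) even multiplicity. -/
def omegaT (m : FreeAbMonoid P) : ℤ :=
  ((m.support.filter fun p => Odd (m p)).card : ℤ) -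
    ((m.support.filter fun p => Even (m p)).card : ℤ)

/-- The standard normal distribution function. -/
def Phi (a : ℝ) : ℝ := 1 / √(2 * Real.pi) * ∫ u in Set.Iic a, Real.exp (-u ^ 2 / 2)

/-- The function `g` obeys the Erdős–Kac law (mean and variance `log log N(m)`) over the
subset `S`, as `x → ∞` in `X`. -/
def ErdosKacLaw (N : P → ℕ) (X : Set ℚ) (S : Set (FreeAbMonoid P)) (g : FreeAbMonoid P → ℝ) : Prop :=
  ∀ a : ℝ, Tendsto
    (fun x : ℚ =>
      ({m ∈ upTo N S x | 3 ≤ elementNorm N m ∧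
          (g m - Real.log (Real.log (elementNorm N m))) / √(Real.log (Real.log (elementNorm N m))) ≤ a}.ncard : ℝ)
        / ((upTo N S x).ncard : ℝ))
    (atTopIn X) (nhds (Phi a))

end ErdosKacMonoid

end

noncomputable section

namespace ErdosKacMonoid

variable {P : Type*}

/-! ### The norm and the counting function -/

/-! Write `ω a` for `a.support.card`. Every `k`-full element is uniquely `k • a + b` with `a`
arbitrary and all nonzero multiplicities of `b` strictly between `k` and `2 * k`. For fixed `b`, the
norm is at most `x` exactly when `N a ≤ (x / N b) ^ (1 / k)`. Each of the three functions takes the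
value one at the `k`-th power of a prime element, so `g (k • a + b)` differs from `ω a` by an amount
that is bounded on average, and the double logarithm of the norm moves by a bounded amount for most
`a`. Thus each fibre inherits the Erdős–Kac law of `ω`. Since the sum of `N b ^ (-1 / k)` converges,
the fibres recombine by dominated convergence (`tendsto_density_fullBall`).

For `ω` itself, characteristic functions replace moments. Only primes up to `z = y ^ (1 / loglog y)`
are kept, and `w ^ ω` with `w = exp (i t / √(loglog y))` is expanded over squarefree divisors.
Counting the multiples of each divisor gives the main term `κ y ∏ (1 + (w - 1) / N p)`. The error
saves a factor `y ^ (-1 / log z) = 1 / log y` and loses only a product of size `exp (O (√(loglog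
y)))`, because `|w - 1| ≤ |t| / √(loglog y)`; no sieve is needed (`tendsto_truncatedCharFun`). A
weak Mertens theorem (`tendsto_primeSum`) turns the main term into the Gaussian, primes above `z`
are negligible in mean (`tendsto_charFun_normalized`), and Lévy's continuity theorem concludes
(`tendsto_cdf_of_charFun`).

The asymptotic count is known only at points of `X`. Closure under quotients makes it available at
`y / N d` when `y` is a norm, and such `y` suffice because balls change only at norms
(`tendsto_of_tendsto_norms`). -/

theorem elementNorm_zero (N : P → ℕ) : elementNorm N 0 = 1 := Finsupp.prod_zero_index

theorem elementNorm_add (N : P → ℕ) (a b : FreeAbMonoid P) :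
    elementNorm N (a + b) = elementNorm N a * elementNorm N b := by
  classical
  exact Finsupp.prod_add_index' (fun p => pow_zero _) fun p i j => pow_add _ _ _

theorem elementNorm_smul (N : P → ℕ) (k : ℕ) (a : FreeAbMonoid P) :
    elementNorm N (k • a) = elementNorm N a ^ k := by
  induction k with
  | zero => simp [elementNorm_zero]
  | succ k ih => rw [succ_nsmul, elementNorm_add, ih, pow_succ]

theorem elementNorm_single (N : P → ℕ) (p : P) (n : ℕ) :
    elementNorm N (Finsupp.single p n) = N p ^ n := Finsupp.prod_single_index (pow_zero _)

theorem elementNorm_pos {N : P → ℕ} (hN : ∀ p, 1 < N p) (a : FreeAbMonoid P) :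
    0 < elementNorm N a :=
  Finset.prod_pos fun p _ => pow_pos (by have := hN p; omega) _

theorem one_le_elementNorm {N : P → ℕ} (hN : ∀ p, 1 < N p) (a : FreeAbMonoid P) :
    (1 : ℝ) ≤ elementNorm N a := by
  exact_mod_cast elementNorm_pos hN a

theorem elementNorm_le_of_le {N : P → ℕ} (hN : ∀ p, 1 < N p) {a b : FreeAbMonoid P} (h : a ≤ b) :
    elementNorm N a ≤ elementNorm N b := by
  obtain ⟨c, rfl⟩ := exists_add_of_le h
  rw [elementNorm_add]
  exact Nat.le_mul_of_pos_right _ (elementNorm_pos hN c)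

theorem norm_le_elementNorm {N : P → ℕ} (hN : ∀ p, 1 < N p) {a : FreeAbMonoid P} {p : P}
    (h : a p ≠ 0) : N p ≤ elementNorm N a := by
  have h1 : Finsupp.single p 1 ≤ a := by
    rw [Finsupp.single_le_iff]; omega
  simpa [elementNorm_single] using elementNorm_le_of_le hN h1

/-- The squarefree element with support `s`. -/
def squarefreeElement (s : Finset P) : FreeAbMonoid P := Finsupp.indicator s fun _ _ => 1

theorem squarefreeElement_le_iff (s : Finset P) (a : FreeAbMonoid P) :
    squarefreeElement s ≤ a ↔ ∀ p ∈ s, a p ≠ 0 := by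
  classical
  simp only [Finsupp.le_def, squarefreeElement, Finsupp.indicator_apply]
  refine forall_congr' fun p => ?_
  by_cases hp : p ∈ s
  · simp [hp, Nat.one_le_iff_ne_zero]
  · simp [hp]

theorem elementNorm_squarefreeElement (N : P → ℕ) (s : Finset P) :
    elementNorm N (squarefreeElement s) = ∏ p ∈ s, N p := by
  classical
  unfold elementNorm squarefreeElement
  rw [Finsupp.prod_indicator_index_eq_prod_attach _ (fun p _ => pow_zero _)]
  simp [Finset.prod_attach s fun p => N p]

theorem squarefreeElement_injective : Function.Injective (squarefreeElement (P := P)) := by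
  classical
  intro s t h
  ext p
  have := DFunLike.congr_fun h p
  simp only [squarefreeElement, Finsupp.indicator_apply] at this
  by_cases h1 : p ∈ s <;> by_cases h2 : p ∈ t <;> simp_all

/-- The finite set of elements of norm at most `u` (empty if there are infinitely many). -/
def normBall (N : P → ℕ) (u : ℝ) : Finset (FreeAbMonoid P) :=
  open Classical in
  if h : {m : FreeAbMonoid P | (elementNorm N m : ℝ) ≤ u}.Finite then h.toFinset else ∅

/-- All norms are at least two, and the number of elements of norm at most `u` lies between `c u`
and `C u`. -/
structure LinearGrowth (N : P → ℕ) (c C : ℝ) : Prop where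
  one_lt : ∀ p, 1 < N p
  finite : ∀ u : ℝ, {m : FreeAbMonoid P | (elementNorm N m : ℝ) ≤ u}.Finite
  pos : 0 < c
  lower : ∀ u : ℝ, 1 ≤ u → c * u ≤ (normBall N u).card
  upper : ∀ u : ℝ, 0 ≤ u → ((normBall N u).card : ℝ) ≤ C * u

namespace LinearGrowth

variable {N : P → ℕ} {c C : ℝ}

theorem mem_normBall (h : LinearGrowth N c C) {u : ℝ} {m : FreeAbMonoid P} :
    m ∈ normBall N u ↔ (elementNorm N m : ℝ) ≤ u := by
  unfold normBall
  rw [dif_pos (h.finite u)]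
  simp

theorem const_pos (h : LinearGrowth N c C) : 0 < C := by
  have h1 := h.lower 1 le_rfl
  have h2 := h.upper 1 zero_le_one
  linarith [h.pos]

theorem card_pos (h : LinearGrowth N c C) {u : ℝ} (hu : 1 ≤ u) :
    (0 : ℝ) < (normBall N u).card := by
  have := h.lower u hu
  have := h.pos
  nlinarith

/-- Translation by `d` maps the smaller ball bijectively onto the multiples of `d`. -/
theorem card_filter_le (h : LinearGrowth N c C) (y : ℝ) (d : FreeAbMonoid P) :
    open Classical in
    ((normBall N y).filter fun a => d ≤ a).card = (normBall N (y / elementNorm N d)).card := by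
  classical
  have hd : (0 : ℝ) < elementNorm N d := by exact_mod_cast elementNorm_pos h.one_lt d
  rw [← Finset.card_image_of_injective (normBall N (y / elementNorm N d))
    (add_left_injective d)]
  congr 1
  ext a
  simp only [Finset.mem_filter, Finset.mem_image, h.mem_normBall]
  constructor
  · rintro ⟨h1, h2⟩
    obtain ⟨b, rfl⟩ := exists_add_of_le h2
    refine ⟨b, ?_, add_comm _ _⟩
    rw [le_div_iff₀ hd]
    rw [elementNorm_add] at h1
    push_cast at h1
    linarith
  · rintro ⟨b, h1, rfl⟩
    rw [le_div_iff₀ hd] at h1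
    refine ⟨?_, le_add_self⟩
    rw [elementNorm_add]
    exact_mod_cast h1

theorem card_filter_le_bound (h : LinearGrowth N c C) {y : ℝ} (hy : 0 ≤ y) (d : FreeAbMonoid P) :
    open Classical in
    (((normBall N y).filter fun a => d ≤ a).card : ℝ) ≤ C * y * (elementNorm N d : ℝ)⁻¹ := by
  rw [h.card_filter_le, mul_assoc, ← div_eq_mul_inv]
  exact h.upper _ (by positivity)

theorem finite_primes (h : LinearGrowth N c C) (z : ℝ) : {p : P | (N p : ℝ) ≤ z}.Finite := by
  refine Set.Finite.of_injOn (f := fun p => (Finsupp.single p 1 : FreeAbMonoid P)) ?_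
    (Finsupp.single_left_injective one_ne_zero).injOn (h.finite z)
  intro p hp
  simpa [elementNorm_single] using hp

end LinearGrowth

/-- The finite set of prime elements of norm at most `z` (empty if there are infinitely many). -/
def primesUpTo (N : P → ℕ) (z : ℝ) : Finset P :=
  open Classical in if h : {p : P | (N p : ℝ) ≤ z}.Finite then h.toFinset else ∅

theorem LinearGrowth.mem_primesUpTo {N : P → ℕ} {c C : ℝ} (h : LinearGrowth N c C) {z : ℝ} {p : P} :
    p ∈ primesUpTo N z ↔ (N p : ℝ) ≤ z := by
  unfold primesUpTo
  rw [dif_pos (h.finite_primes z)]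
  simp

/-- The sum of the reciprocals of the norms of the prime elements of norm at most `z`. -/
def primeSum (N : P → ℕ) (z : ℝ) : ℝ := ∑ p ∈ primesUpTo N z, (N p : ℝ)⁻¹

theorem primeSum_nonneg (N : P → ℕ) (z : ℝ) : 0 ≤ primeSum N z :=
  Finset.sum_nonneg fun _ _ => by positivity

/-! ### Sums over prime elements -/

theorem half_rpow_le {δ : ℝ} (h0 : 0 ≤ δ) (h1 : δ ≤ 1) : (1 / 2 : ℝ) ^ δ ≤ 1 - δ / 2 := by
  have := rpow_one_add_le_one_add_mul_self (s := -(1 / 2)) (by norm_num) h0 h1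
  norm_num at this ⊢
  linarith

theorem elementNorm_rpow_eq_prod (N : P → ℕ) (s : ℝ) (m : FreeAbMonoid P) :
    (elementNorm N m : ℝ) ^ s = m.prod fun p n => ((N p : ℝ) ^ s) ^ n := by
  unfold elementNorm Finsupp.prod
  push_cast
  rw [← Real.finsetProd_rpow _ _ (fun p _ => by positivity)]
  refine Finset.prod_congr rfl fun p _ => ?_
  rw [← Real.rpow_natCast, ← Real.rpow_natCast, ← Real.rpow_mul (by positivity),
    ← Real.rpow_mul (by positivity), mul_comm]

/-- A finite Euler product: expanding the right side yields one nonnegative term for each element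
supported in `Q` with multiplicities in `J`, and `F` consists of some of these. -/
theorem sum_prod_le_prod_sum (Q : Finset P) (J : Finset ℕ) (φ : P → ℕ → ℝ)
    (hφ : ∀ p n, 0 ≤ φ p n) (hφ0 : ∀ p, φ p 0 = 1) (F : Finset (FreeAbMonoid P))
    (hF : ∀ m ∈ F, m.support ⊆ Q ∧ ∀ p ∈ Q, m p ∈ J) :
    ∑ m ∈ F, m.prod φ ≤ ∏ p ∈ Q, ∑ j ∈ J, φ p j := by
  classical
  have hsub : F ⊆ Q.finsupp fun _ => J := by
    intro m hm
    rw [Finset.mem_finsupp_iff]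
    exact hF m hm
  refine (Finset.sum_le_sum_of_subset_of_nonneg hsub fun m _ _ =>
    Finset.prod_nonneg fun p _ => hφ _ _).trans_eq ?_
  rw [Finset.prod_sum, Finset.finsupp, Finset.sum_map]
  refine Finset.sum_congr rfl fun g _ => ?_
  change (Finsupp.indicator Q g).prod φ = _
  rw [Finsupp.prod_of_support_subset _ (s := Q) _ _ fun p _ => hφ0 p]
  · rw [← Finset.prod_attach]
    refine Finset.prod_congr rfl fun p _ => ?_
    simp
  · exact Finsupp.support_indicator_subset _ _

theorem sum_le_inv_one_sub (J : Finset ℕ) {x : ℝ} (h0 : 0 ≤ x) (h1 : x < 1) :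
    ∑ j ∈ J, x ^ j ≤ (1 - x)⁻¹ := by
  rw [← tsum_geometric_of_lt_one h0 h1]
  exact (summable_geometric_of_lt_one h0 h1).sum_le_tsum _ fun _ _ => by positivity

theorem inv_one_sub_le_exp {x : ℝ} (h1 : x ≤ 1 / 2) :
    (1 - x)⁻¹ ≤ Real.exp (x + 2 * x ^ 2) := by
  refine le_trans ?_ (Real.add_one_le_exp _)
  rw [inv_le_iff_one_le_mul₀ (by linarith)]
  nlinarith [mul_nonneg (sq_nonneg x) (by linarith : (0 : ℝ) ≤ 1 - 2 * x)]

theorem sub_sq_le_log {x : ℝ} (h0 : 0 ≤ x) : x - x ^ 2 ≤ Real.log (1 + x) := by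
  refine le_trans ?_ (Real.le_log_one_add_of_nonneg h0)
  rw [le_div_iff₀ (by linarith)]
  nlinarith [pow_nonneg h0 3, pow_nonneg h0 2]

namespace LinearGrowth

variable {N : P → ℕ} {c C : ℝ}

theorem two_le (h : LinearGrowth N c C) (p : P) : (2 : ℝ) ≤ N p := by
  exact_mod_cast h.one_lt p

theorem inv_le_half (h : LinearGrowth N c C) (p : P) : (N p : ℝ)⁻¹ ≤ 1 / 2 := by
  rw [one_div]
  exact inv_anti₀ two_pos (h.two_le p)

/-- Dyadic blocks: at most `C * 2 ^ (j + 1)` norms lie in `[2 ^ j, 2 ^ (j + 1))`, so the block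
contributes at most `2 * C * 2 ^ (-j δ)`, and the geometric series has the order of a simple pole at
`δ = 0`. -/
theorem sum_rpow_le (h : LinearGrowth N c C) {δ : ℝ} (h0 : 0 < δ) (h1 : δ ≤ 1)
    (F : Finset (FreeAbMonoid P)) :
    ∑ m ∈ F, (elementNorm N m : ℝ) ^ (-(1 + δ)) ≤ 4 * C / δ := by
  classical
  have hC := h.const_pos
  set r : ℝ := (1 / 2) ^ δ
  have hr0 : 0 ≤ r := by positivity
  have hr : r ≤ 1 - δ / 2 := half_rpow_le h0.le h1
  have hr1 : r < 1 := by linarith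
  have key : ∀ j : ℕ, ∑ m ∈ F with Nat.log 2 (elementNorm N m) = j,
      (elementNorm N m : ℝ) ^ (-(1 + δ)) ≤ 2 * C * r ^ j := by
    intro j
    have hb : ∀ m ∈ F.filter (fun m => Nat.log 2 (elementNorm N m) = j),
        (elementNorm N m : ℝ) ^ (-(1 + δ)) ≤ (2 ^ j : ℝ)⁻¹ * r ^ j := by
      intro m hm
      rw [Finset.mem_filter] at hm
      have h2 : 2 ^ j ≤ elementNorm N m := by
        rw [← hm.2]
        exact Nat.pow_log_le_self _ (elementNorm_pos h.one_lt m).ne'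
      have h2' : (2 ^ j : ℝ) ≤ elementNorm N m := by exact_mod_cast h2
      refine (Real.rpow_le_rpow_of_nonpos (by positivity) h2' (by linarith)).trans_eq ?_
      rw [neg_add, Real.rpow_add (by positivity), Real.rpow_neg_one]
      congr 1
      simp only [r]
      rw [← Real.rpow_natCast, ← Real.rpow_natCast, ← Real.rpow_mul (by positivity),
        ← Real.rpow_mul (by positivity), one_div, Real.inv_rpow (by positivity),
        ← Real.rpow_neg (by positivity)]
      ring_nf
    refine (Finset.sum_le_card_nsmul _ _ _ hb).trans ?_
    rw [nsmul_eq_mul]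
    have hcard : ((F.filter fun m => Nat.log 2 (elementNorm N m) = j).card : ℝ)
        ≤ C * 2 ^ (j + 1) := by
      refine le_trans ?_ (h.upper (2 ^ (j + 1)) (by positivity))
      exact_mod_cast Finset.card_le_card fun m hm => by
        rw [Finset.mem_filter] at hm
        rw [h.mem_normBall]
        have := Nat.lt_pow_succ_log_self (b := 2) (by norm_num) (elementNorm N m)
        rw [hm.2] at this
        exact_mod_cast this.le
    calc _ ≤ C * 2 ^ (j + 1) * ((2 ^ j : ℝ)⁻¹ * r ^ j) := by gcongr
      _ = _ := by field_simp; ring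
  rw [← Finset.sum_fiberwise_of_maps_to (s := F)
    (t := F.image fun m => Nat.log 2 (elementNorm N m))
    (g := fun m => Nat.log 2 (elementNorm N m)) fun m hm => Finset.mem_image.2 ⟨m, hm, rfl⟩]
  refine (Finset.sum_le_sum fun j _ => key j).trans ?_
  rw [← Finset.mul_sum]
  calc _ ≤ 2 * C * (1 - r)⁻¹ := by
        gcongr
        exact sum_le_inv_one_sub _ hr0 hr1
    _ ≤ 2 * C * (δ / 2)⁻¹ := by
        gcongr
        linarith
    _ = _ := by field_simp; ring

theorem sum_prime_rpow_le (h : LinearGrowth N c C) {δ : ℝ} (h0 : 0 < δ) (h1 : δ ≤ 1)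
    (Q : Finset P) : ∑ p ∈ Q, (N p : ℝ) ^ (-(1 + δ)) ≤ 4 * C / δ := by
  classical
  have := h.sum_rpow_le h0 h1 (Q.image fun p => Finsupp.single p 1)
  rw [Finset.sum_image fun p _ q _ hpq => Finsupp.single_left_injective one_ne_zero hpq] at this
  simpa [elementNorm_single] using this

theorem sum_prime_inv_sq_le (h : LinearGrowth N c C) (Q : Finset P) :
    ∑ p ∈ Q, ((N p : ℝ)⁻¹) ^ 2 ≤ 4 * C := by
  have := h.sum_prime_rpow_le one_pos le_rfl Q
  rw [div_one] at this
  refine le_trans (le_of_eq (Finset.sum_congr rfl fun p _ => ?_)) this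
  rw [Real.rpow_neg (by positivity)]
  norm_num

/-- Partial summation: `1 / N m` is bounded below by a telescoping sum of `1 / (j (j + 1))`. After
interchange, the lower bound `c * j` on the balls leaves half a harmonic sum. -/
theorem log_le_sum_inv (h : LinearGrowth N c C) {x : ℝ} (hx : 1 ≤ x) :
    c / 2 * Real.log x ≤ ∑ m ∈ normBall N x, (elementNorm N m : ℝ)⁻¹ := by
  have hc := h.pos
  set J := ⌊x⌋₊
  have hJx : (J : ℝ) ≤ x := Nat.floor_le (by linarith)
  set g : ℕ → ℝ := fun j => (j : ℝ)⁻¹ - ((j + 1 : ℕ) : ℝ)⁻¹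
  have h1 : ∀ m ∈ normBall N x, ∑ j ∈ Finset.Ico (elementNorm N m) (J + 1), g j
      ≤ (elementNorm N m : ℝ)⁻¹ := by
    intro m hm
    rw [h.mem_normBall] at hm
    have hm' : elementNorm N m ≤ J + 1 := (Nat.le_floor hm).trans (Nat.le_succ _)
    rw [Finset.sum_Ico_eq_sub _ hm', Finset.sum_range_sub' (fun j : ℕ => (j : ℝ)⁻¹),
      Finset.sum_range_sub' (fun j : ℕ => (j : ℝ)⁻¹)]
    have : (0 : ℝ) ≤ ((J + 1 : ℕ) : ℝ)⁻¹ := by positivity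
    linarith
  refine le_trans ?_ (Finset.sum_le_sum h1)
  rw [Finset.sum_comm' (s' := fun j => normBall N (j : ℝ)) (t' := Finset.Icc 1 J)]
  · have h2 : ∀ j ∈ Finset.Icc 1 J, c / 2 * (j : ℝ)⁻¹ ≤ ∑ _m ∈ normBall N (j : ℝ), g j := by
      intro j hj
      rw [Finset.mem_Icc] at hj
      have hj1 : (1 : ℝ) ≤ j := by exact_mod_cast hj.1
      rw [Finset.sum_const, nsmul_eq_mul]
      have hg : g j = ((j : ℝ) * (j + 1))⁻¹ := by
        simp only [g]
        push_cast
        field_simp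
        ring
      rw [hg]
      calc c / 2 * (j : ℝ)⁻¹ ≤ c * j * ((j : ℝ) * (j + 1))⁻¹ := by
            rw [mul_inv]
            have : (2 : ℝ)⁻¹ * (j : ℝ)⁻¹ ≤ ((j : ℝ) + 1)⁻¹ := by
              rw [← mul_inv]
              exact inv_anti₀ (by positivity) (by linarith)
            have e : c * j * ((j : ℝ)⁻¹ * ((j : ℝ) + 1)⁻¹) = c * ((j : ℝ) + 1)⁻¹ := by field_simp
            rw [e]
            nlinarith
        _ ≤ _ := by
            gcongr
            exact h.lower j hj1
    refine le_trans ?_ (Finset.sum_le_sum h2)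
    rw [← Finset.mul_sum]
    gcongr
    have h3 := log_add_one_le_harmonic J
    rw [harmonic_eq_sum_Icc] at h3
    push_cast at h3
    refine le_trans (Real.log_le_log (by linarith) ?_) h3
    exact (Nat.lt_floor_add_one x).le
  · intro m j
    simp only [h.mem_normBall, Finset.mem_Ico, Finset.mem_Icc]
    have := elementNorm_pos h.one_lt m
    constructor
    · rintro ⟨-, h2, h3⟩
      exact ⟨by exact_mod_cast h2, by omega, by omega⟩
    · rintro ⟨h2, h3, h4⟩
      have h2' : elementNorm N m ≤ j := by exact_mod_cast h2
      refine ⟨?_, h2', by omega⟩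
      exact h2.trans (le_trans (by exact_mod_cast h4) hJx)

/-- All primes dividing an element of the ball have norm at most `x`, so the sum is dominated by the
Euler product over these primes. The quadratic terms of its logarithm add up to at most `2 * (4 *
C)`. -/
theorem sum_inv_le_exp (h : LinearGrowth N c C) (x : ℝ) :
    ∑ m ∈ normBall N x, (elementNorm N m : ℝ)⁻¹ ≤ Real.exp (primeSum N x + 8 * C) := by
  classical
  set Q := primesUpTo N x
  have h1 := sum_prod_le_prod_sum Q (((normBall N x) ×ˢ Q).image fun a => a.1 a.2)
    (fun p n => ((N p : ℝ) ^ (-1 : ℝ)) ^ n) (fun _ _ => by positivity) (fun _ => pow_zero _)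
    (normBall N x) fun m hm => ⟨fun p hp => ?_, fun p hp => ?_⟩
  · simp_rw [← elementNorm_rpow_eq_prod, Real.rpow_neg_one] at h1
    refine h1.trans ?_
    calc _ ≤ ∏ p ∈ Q, Real.exp ((N p : ℝ)⁻¹ + 2 * ((N p : ℝ)⁻¹) ^ 2) := by
          refine Finset.prod_le_prod (fun p _ => Finset.sum_nonneg fun _ _ => by positivity)
            fun p _ => ?_
          have := h.inv_le_half p
          exact (sum_le_inv_one_sub _ (by positivity) (by linarith)).trans
            (inv_one_sub_le_exp this)
      _ = Real.exp (∑ p ∈ Q, ((N p : ℝ)⁻¹ + 2 * ((N p : ℝ)⁻¹) ^ 2)) := (Real.exp_sum _ _).symm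
      _ ≤ _ := by
          rw [Finset.sum_add_distrib, ← Finset.mul_sum]
          have := h.sum_prime_inv_sq_le Q
          refine Real.exp_le_exp.2 ?_
          change primeSum N x + _ ≤ _
          linarith
  · rw [h.mem_primesUpTo]
    rw [h.mem_normBall] at hm
    refine le_trans ?_ hm
    exact_mod_cast norm_le_elementNorm h.one_lt (Finsupp.mem_support_iff.1 hp)
  · exact Finset.mem_image.2 ⟨(m, p), Finset.mem_product.2 ⟨hm, hp⟩, rfl⟩

theorem loglog_le_primeSum (h : LinearGrowth N c C) {x : ℝ} (hx : 1 < x) :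
    Real.log (Real.log x) + Real.log (c / 2) - 8 * C ≤ primeSum N x := by
  have hl : 0 < Real.log x := Real.log_pos hx
  have h1 := (h.log_le_sum_inv hx.le).trans (h.sum_inv_le_exp x)
  have hc := h.pos
  have h2 := Real.log_le_log (by positivity) h1
  rw [Real.log_exp, Real.log_mul (by positivity) hl.ne'] at h2
  linarith

/-- Summing over squarefree elements gives `∏ (1 + N p ^ (-(1 + δ))) ≤ 4 * C / δ`. Taking logarithms
yields the true order `log (1 / δ)`, where `sum_prime_rpow_le` has only `1 / δ`. -/
theorem sum_prime_rpow_le_log (h : LinearGrowth N c C) {δ : ℝ} (h0 : 0 < δ) (h1 : δ ≤ 1)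
    (Q : Finset P) :
    ∑ p ∈ Q, (N p : ℝ) ^ (-(1 + δ)) ≤ Real.log (4 * C / δ) + 4 * C := by
  classical
  have hsum := h.sum_rpow_le h0 h1 (Q.powerset.image squarefreeElement)
  rw [Finset.sum_image fun s _ t _ hst => squarefreeElement_injective hst] at hsum
  have e : ∑ s ∈ Q.powerset, (elementNorm N (squarefreeElement s) : ℝ) ^ (-(1 + δ))
      = ∏ p ∈ Q, (1 + (N p : ℝ) ^ (-(1 + δ))) := by
    rw [Finset.prod_one_add]
    refine Finset.sum_congr rfl fun s _ => ?_
    rw [elementNorm_squarefreeElement]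
    push_cast
    rw [Real.finsetProd_rpow _ _ (fun p _ => by positivity)]
  rw [e] at hsum
  have h2 := Real.log_le_log (Finset.prod_pos fun p _ => by positivity) hsum
  rw [Real.log_prod (fun p _ => by positivity)] at h2
  have h3 : ∀ p ∈ Q, (N p : ℝ) ^ (-(1 + δ)) - ((N p : ℝ)⁻¹) ^ 2
      ≤ Real.log (1 + (N p : ℝ) ^ (-(1 + δ))) := by
    intro p _
    refine le_trans ?_ (sub_sq_le_log (by positivity))
    have : (N p : ℝ) ^ (-(1 + δ)) ≤ (N p : ℝ)⁻¹ := by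
      rw [← Real.rpow_neg_one]
      exact Real.rpow_le_rpow_of_exponent_le (by linarith [h.two_le p]) (by linarith)
    gcongr
  have h4 := (Finset.sum_le_sum h3).trans h2
  rw [Finset.sum_sub_distrib] at h4
  linarith [h.sum_prime_inv_sq_le Q]

/-- Rankin's trick: `1 ≤ (x / N p) ^ δ` for the primes that are counted. -/
theorem primeSum_le (h : LinearGrowth N c C) {x δ : ℝ} (hx : 1 ≤ x) (h0 : 0 < δ) (h1 : δ ≤ 1) :
    primeSum N x ≤ x ^ δ * (Real.log (4 * C / δ) + 4 * C) := by
  refine le_trans ?_ (mul_le_mul_of_nonneg_left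
    (h.sum_prime_rpow_le_log h0 h1 (primesUpTo N x)) (by positivity))
  rw [Finset.mul_sum]
  refine Finset.sum_le_sum fun p hp => ?_
  rw [h.mem_primesUpTo] at hp
  have hp0 : (0 : ℝ) < N p := by linarith [h.two_le p]
  calc (N p : ℝ)⁻¹ = (N p : ℝ) ^ δ * (N p : ℝ) ^ (-(1 + δ)) := by
        rw [← Real.rpow_add hp0, ← Real.rpow_neg_one]
        ring_nf
    _ ≤ _ := by gcongr

theorem exists_abs_primeSum_sub_le (h : LinearGrowth N c C) :
    ∃ K : ℝ, ∀ᶠ x : ℝ in atTop, |primeSum N x - Real.log (Real.log x)|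
      ≤ 3 * Real.log (Real.log (Real.log x)) + K := by
  have hC := h.const_pos
  set K₀ := |Real.log (4 * C)| + 4 * C
  have hK₀ : 0 ≤ K₀ := by positivity
  refine ⟨|Real.log (c / 2) - 8 * C| + (3 * K₀ + 2), ?_⟩
  have hL : Tendsto (fun x : ℝ => Real.log (Real.log x)) atTop atTop :=
    Real.tendsto_log_atTop.comp Real.tendsto_log_atTop
  filter_upwards [eventually_gt_atTop 1, Real.tendsto_log_atTop.eventually_ge_atTop 1,
    hL.eventually_ge_atTop 1] with x hx hl hL1
  set L := Real.log (Real.log x) with hLdef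
  have hlogL : 0 ≤ Real.log L := Real.log_nonneg hL1
  have hlow := h.loglog_le_primeSum hx
  -- With `δ = 1 / log x` the factor `x ^ δ` would be `e` and spoil the leading coefficient. The
  -- extra `L` makes it `1 + O (1 / L)`, at the price of a term `log L` in `log (1 / δ)`.
  have hup := h.primeSum_le (δ := (Real.log x * L)⁻¹) hx.le (by positivity)
    (inv_le_one_of_one_le₀ (by nlinarith))
  have e1 : x ^ (Real.log x * L)⁻¹ = Real.exp L⁻¹ := by
    rw [Real.rpow_def_of_pos (by linarith)]
    congr 1
    field_simp
  have e2 : Real.exp L⁻¹ ≤ 1 + 2 * L⁻¹ := by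
    have hb := Real.abs_exp_sub_one_le (x := L⁻¹)
      (by rw [abs_of_pos (by positivity)]; exact inv_le_one_of_one_le₀ hL1)
    rw [abs_of_pos (a := L⁻¹) (by positivity)] at hb
    linarith [(abs_le.1 hb).2]
  have e3 : Real.log (4 * C / (Real.log x * L)⁻¹) = Real.log (4 * C) + L + Real.log L := by
    rw [div_inv_eq_mul, Real.log_mul (by positivity) (by positivity),
      Real.log_mul (x := Real.log x) (by positivity) (by positivity), ← hLdef]
    ring
  rw [e1, e3] at hup
  have hup' : primeSum N x ≤ (1 + 2 * L⁻¹) * (L + Real.log L + K₀) := by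
    refine hup.trans ?_
    have : Real.log (4 * C) ≤ |Real.log (4 * C)| := le_abs_self _
    have h5 : Real.log (4 * C) + L + Real.log L + 4 * C ≤ L + Real.log L + K₀ := by
      simp only [K₀]; linarith
    refine (mul_le_mul_of_nonneg_left h5 (Real.exp_pos _).le).trans ?_
    gcongr
  have hinv : L⁻¹ ≤ 1 := inv_le_one_of_one_le₀ hL1
  have hinv0 : 0 < L⁻¹ := by positivity
  have hLL : L⁻¹ * L = 1 := inv_mul_cancel₀ (by positivity)
  have h6 : (1 + 2 * L⁻¹) * (L + Real.log L + K₀)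
      ≤ L + 2 + 3 * Real.log L + 3 * K₀ := by
    nlinarith [mul_le_mul_of_nonneg_right hinv (by positivity : 0 ≤ Real.log L + K₀)]
  have h7 := neg_abs_le (Real.log (c / 2) - 8 * C)
  have h8 := abs_nonneg (Real.log (c / 2) - 8 * C)
  rw [abs_le]
  constructor <;> linarith

/-- A weak form of Mertens' second theorem. -/
theorem tendsto_primeSum (h : LinearGrowth N c C) :
    Tendsto (fun x : ℝ => (primeSum N x - Real.log (Real.log x)) / √(Real.log (Real.log x)))
      atTop (nhds 0) := by
  obtain ⟨K, hK⟩ := h.exists_abs_primeSum_sub_le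
  have hL : Tendsto (fun x : ℝ => Real.log (Real.log x)) atTop atTop :=
    Real.tendsto_log_atTop.comp Real.tendsto_log_atTop
  have hlim : Tendsto (fun L : ℝ => (3 * Real.log L + K) / √L) atTop (nhds 0) := by
    have h1 : Tendsto (fun L : ℝ => Real.log L / L ^ (1 / 2 : ℝ)) atTop (nhds 0) :=
      (isLittleO_log_rpow_atTop (by norm_num)).tendsto_div_nhds_zero
    have h2 : Tendsto (fun L : ℝ => K / √L) atTop (nhds 0) :=
      Real.tendsto_sqrt_atTop.const_div_atTop K
    have h3 := (h1.const_mul 3).add h2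
    rw [mul_zero, add_zero] at h3
    refine h3.congr fun L => ?_
    rw [Real.sqrt_eq_rpow]
    ring
  refine squeeze_zero_norm' ?_ (hlim.comp hL)
  filter_upwards [hK] with x hx
  rw [Real.norm_eq_abs, abs_div, abs_of_nonneg (Real.sqrt_nonneg _)]
  simp only [Function.comp]
  gcongr

end LinearGrowth
/-! ### The characteristic function of the truncated prime divisor function -/

/-- The iterated logarithm. -/
abbrev loglog (x : ℝ) : ℝ := Real.log (Real.log x)

theorem tendsto_loglog : Tendsto loglog atTop atTop :=
  Real.tendsto_log_atTop.comp Real.tendsto_log_atTop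

theorem tendsto_log_div_sqrt : Tendsto (fun L : ℝ => Real.log L / √L) atTop (nhds 0) := by
  have h1 : Tendsto (fun L : ℝ => Real.log L / L ^ (1 / 2 : ℝ)) atTop (nhds 0) :=
    (isLittleO_log_rpow_atTop (by norm_num)).tendsto_div_nhds_zero
  simpa only [← Real.sqrt_eq_rpow] using h1

/-- The truncation level `y ^ (1 / log log y)`. -/
def truncation (y : ℝ) : ℝ := Real.exp (Real.log y / loglog y)

theorem tendsto_truncation : Tendsto truncation atTop atTop := by
  refine Real.tendsto_exp_atTop.comp ?_
  have h1 : Tendsto (fun u : ℝ => Real.log u / u) atTop (nhds 0) :=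
    Real.isLittleO_log_id_atTop.tendsto_div_nhds_zero
  have h2 : Tendsto (fun u : ℝ => Real.log u / u) atTop (nhdsWithin 0 (Set.Ioi 0)) := by
    rw [tendsto_nhdsWithin_iff]
    refine ⟨h1, ?_⟩
    filter_upwards [eventually_gt_atTop 1] with u hu
    have := Real.log_pos hu
    exact Set.mem_Ioi.2 (by positivity)
  have h3 := (tendsto_inv_nhdsGT_zero.comp h2).comp Real.tendsto_log_atTop
  refine h3.congr fun y => ?_
  simp [loglog]

/-- The number of elements of `Q` that divide `a`. -/
def omegaIn (Q : Finset P) (a : FreeAbMonoid P) : ℕ := (Q.filter fun p => a p ≠ 0).card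

/-- Expansion of the product over `p ∈ Q` of `1 + (w - 1)` or `1`, according as `p` divides `a` or
not. -/
theorem pow_omegaIn (Q : Finset P) (a : FreeAbMonoid P) (w : ℂ) :
    open Classical in
    w ^ omegaIn Q a
      = ∑ s ∈ Q.powerset, if squarefreeElement s ≤ a then (w - 1) ^ s.card else 0 := by
  classical
  have h1 : w ^ omegaIn Q a = ∏ p ∈ Q, (1 + if a p ≠ 0 then w - 1 else 0) := by
    rw [omegaIn, ← Finset.prod_const, Finset.prod_filter]
    refine Finset.prod_congr rfl fun p _ => ?_
    split_ifs <;> ring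
  rw [h1, Finset.prod_one_add]
  refine Finset.sum_congr rfl fun s _ => ?_
  rw [Finset.prod_ite_zero, Finset.prod_const]
  simp only [squarefreeElement_le_iff]

/-- Taylor expansion to second order of `exp (i t / σ) - 1`, multiplied by `S = σ ^ 2 + o(σ)`. The
linear term has size `1 / σ`, which is why an error `o(σ)` in `S` is exactly affordable. -/
theorem tendsto_exponent {l : Filter ℝ} {σ S : ℝ → ℝ} (t : ℝ) (hσ : Tendsto σ l atTop)
    (hS : Tendsto (fun y => (S y - σ y ^ 2) / σ y) l (nhds 0)) :
    Tendsto (fun y => (Complex.exp (Complex.I * (t / σ y : ℝ)) - 1) * (S y : ℂ)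
      - Complex.I * (t * σ y : ℝ)) l (nhds (-(t : ℂ) ^ 2 / 2)) := by
  rw [tendsto_iff_norm_sub_tendsto_zero]
  have hinv : Tendsto (fun y => |t| ^ 3 / σ y) l (nhds 0) := hσ.const_div_atTop _
  have hlim : Tendsto (fun y => |t| * |(S y - σ y ^ 2) / σ y| + |t| ^ 3 / σ y) l (nhds 0) := by
    have := (hS.abs.const_mul |t|).add hinv
    simpa using this
  refine squeeze_zero' (Eventually.of_forall fun _ => norm_nonneg _) ?_ hlim
  filter_upwards [hσ.eventually_ge_atTop 1, hσ.eventually_ge_atTop |t|] with y h1 h2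
  have hs : 0 < σ y := by linarith
  set x : ℂ := Complex.I * (t / σ y : ℝ) with hx
  have hxn : ‖x‖ = |t| / σ y := by
    rw [hx, norm_mul, Complex.norm_I, one_mul, Complex.norm_real, Real.norm_eq_abs, abs_div,
      abs_of_pos hs]
  have hx1 : ‖x‖ ≤ 1 := by rw [hxn, div_le_one hs]; exact h2
  have hb := Complex.exp_bound hx1 (n := 3) (by norm_num)
  have hsum : ∑ m ∈ Finset.range 3, x ^ m / (m.factorial : ℂ) = 1 + x + x ^ 2 / 2 := by
    simp [Finset.sum_range_succ, Nat.factorial]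
  rw [hsum] at hb
  have hb' : ‖Complex.exp x - (1 + x + x ^ 2 / 2)‖ ≤ ‖x‖ ^ 3 := by
    refine hb.trans (mul_le_of_le_one_right (by positivity) ?_)
    norm_num [Nat.factorial]
  have hw : ‖Complex.exp x - 1‖ ≤ ‖x‖ := by
    rw [hxn, ← abs_of_pos hs, ← abs_div, ← Real.norm_eq_abs]
    rw [hx]
    simpa [abs_of_pos hs] using Real.norm_exp_I_mul_ofReal_sub_one_le (x := t / σ y)
  have hsc : (σ y : ℂ) ≠ 0 := by exact_mod_cast hs.ne'
  have e1 : x * (σ y : ℂ) ^ 2 = Complex.I * (t * σ y : ℝ) := by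
    rw [hx]; push_cast; field_simp
  have e2 : x ^ 2 * (σ y : ℂ) ^ 2 = -(t : ℂ) ^ 2 := by
    rw [hx]; push_cast; field_simp; rw [Complex.I_sq]; ring
  have e3 : (Complex.exp x - 1) * (S y : ℂ) - Complex.I * (t * σ y : ℝ) - (-(t : ℂ) ^ 2 / 2)
      = (Complex.exp x - 1) * ((S y - σ y ^ 2 : ℝ) : ℂ)
        + (Complex.exp x - (1 + x + x ^ 2 / 2)) * (σ y : ℂ) ^ 2 := by
    rw [← e1]
    push_cast
    linear_combination e2 / 2
  rw [e3]
  refine (norm_add_le _ _).trans (add_le_add ?_ ?_)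
  · rw [norm_mul, Complex.norm_real, Real.norm_eq_abs, abs_div, abs_of_pos hs]
    refine (mul_le_mul_of_nonneg_right hw (abs_nonneg _)).trans_eq ?_
    rw [hxn]; ring
  · rw [norm_mul, norm_pow, Complex.norm_real, Real.norm_eq_abs, abs_of_pos hs]
    refine (mul_le_mul_of_nonneg_right hb' (by positivity)).trans_eq ?_
    rw [hxn]
    field_simp

/-- A quantitative form of `A (y / N d) ∼ κ y / N d`, where `A` is the counting function,
uniform in `d`. -/
def SharpCount (N : P → ℕ) (κ D η y : ℝ) : Prop :=
  ∀ (d : FreeAbMonoid P) (δ : ℝ), 0 ≤ δ → δ ≤ η →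
    |((normBall N (y / elementNorm N d)).card : ℝ) - κ * (y / elementNorm N d)|
      ≤ D * (y / elementNorm N d) ^ (1 - δ)

namespace LinearGrowth

variable {N : P → ℕ} {c C : ℝ}

theorem sum_pow_omegaIn (h : LinearGrowth N c C) (Q : Finset P) (y : ℝ) (w : ℂ) :
    ∑ a ∈ normBall N y, w ^ omegaIn Q a = ∑ s ∈ Q.powerset,
      (w - 1) ^ s.card * ((normBall N (y / elementNorm N (squarefreeElement s))).card : ℂ) := by
  classical
  simp_rw [pow_omegaIn]
  rw [Finset.sum_comm]
  refine Finset.sum_congr rfl fun s _ => ?_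
  rw [← Finset.sum_filter, Finset.sum_const, h.card_filter_le, nsmul_eq_mul, mul_comm]

/-- The count is applied to every squarefree divisor supported in `Q`, even those of norm above `y`.
As `N d ^ (-(1 - δ))` is multiplicative in `d`, the accumulated error is again a product over `Q`.
-/
theorem norm_sum_pow_omegaIn_sub_le (h : LinearGrowth N c C) {κ D η y δ : ℝ} (hy : 0 ≤ y)
    (hD : SharpCount N κ D η y) (h0 : 0 ≤ δ) (h1 : δ ≤ η) (Q : Finset P) (w : ℂ) :
    ‖∑ a ∈ normBall N y, w ^ omegaIn Q a - κ * y * ∏ p ∈ Q, (1 + (w - 1) * (N p : ℂ)⁻¹)‖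
      ≤ D * y ^ (1 - δ) * ∏ p ∈ Q, (1 + ‖w - 1‖ * (N p : ℝ) ^ (-(1 - δ))) := by
  rw [h.sum_pow_omegaIn, Finset.prod_one_add, Finset.mul_sum, ← Finset.sum_sub_distrib,
    Finset.prod_one_add, Finset.mul_sum]
  refine (norm_sum_le _ _).trans (Finset.sum_le_sum fun s _ => ?_)
  have hs := hD (squarefreeElement s) δ h0 h1
  have hnorm : (elementNorm N (squarefreeElement s) : ℝ) = ∏ p ∈ s, (N p : ℝ) := by
    rw [elementNorm_squarefreeElement]; push_cast; rfl
  have e1 : (w - 1) ^ s.card * ((normBall N (y / elementNorm N (squarefreeElement s))).card : ℂ)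
      - κ * y * ∏ p ∈ s, (w - 1) * (N p : ℂ)⁻¹ = (w - 1) ^ s.card *
      ((((normBall N (y / elementNorm N (squarefreeElement s))).card : ℝ) -
        κ * (y / elementNorm N (squarefreeElement s)) : ℝ) : ℂ) := by
    rw [hnorm, Finset.prod_mul_distrib, Finset.prod_const]
    push_cast
    rw [Finset.prod_inv_distrib]
    ring
  rw [e1, norm_mul, norm_pow, Complex.norm_real, Real.norm_eq_abs]
  refine (mul_le_mul_of_nonneg_left hs (by positivity)).trans_eq ?_
  rw [hnorm, Real.div_rpow hy (Finset.prod_nonneg fun _ _ => by positivity),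
    Finset.prod_mul_distrib, Finset.prod_const, Real.finsetProd_rpow _ _ fun _ _ => by positivity,
    Real.rpow_neg (Finset.prod_nonneg fun _ _ => by positivity)]
  ring

/-- For `N p ≤ z` one has `N p ^ (1 / log z) ≤ e`, so the shift of the exponent costs only a factor
`e` per prime. -/
theorem prod_one_add_le (h : LinearGrowth N c C) {z ε : ℝ} (hz : 1 < z) (hε : 0 ≤ ε) :
    ∏ p ∈ primesUpTo N z, (1 + ε * (N p : ℝ) ^ (-(1 - (Real.log z)⁻¹)))
      ≤ Real.exp (Real.exp 1 * ε * primeSum N z) := by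
  have hl := Real.log_pos hz
  rw [primeSum, Finset.mul_sum, Real.exp_sum]
  refine Finset.prod_le_prod (fun p _ => by positivity) fun p hp => ?_
  rw [h.mem_primesUpTo] at hp
  have hp0 : (0 : ℝ) < N p := by linarith [h.two_le p]
  rw [add_comm]
  refine le_trans ?_ (Real.add_one_le_exp _)
  have h1 : (N p : ℝ) ^ (-(1 - (Real.log z)⁻¹)) ≤ Real.exp 1 * (N p : ℝ)⁻¹ := by
    rw [neg_sub, sub_eq_add_neg, Real.rpow_add hp0, Real.rpow_neg_one]
    gcongr
    rw [Real.rpow_def_of_pos hp0]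
    refine Real.exp_le_exp.2 ?_
    rw [← div_eq_mul_inv, div_le_one hl]
    exact Real.log_le_log hp0 hp
  nlinarith [mul_le_mul_of_nonneg_left h1 hε]

/-- Here `log (1 + x) - x` is at most `|x| ^ 2` since `|x| ≤ 1 / 2`, and the inverse squares of the
prime norms sum to at most `4 * C`. -/
theorem exists_prod_eq_exp (h : LinearGrowth N c C) (z : ℝ) {v : ℂ} (hv : ‖v‖ ≤ 1) :
    ∃ ε : ℂ, ‖ε‖ ≤ 4 * C * ‖v‖ ^ 2 ∧ ∏ p ∈ primesUpTo N z, (1 + v * (N p : ℂ)⁻¹)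
      = Complex.exp (v * (primeSum N z : ℂ) + ε) := by
  have hn : ∀ p, ‖v * (N p : ℂ)⁻¹‖ = ‖v‖ * (N p : ℝ)⁻¹ := fun p => by
    rw [norm_mul, norm_inv, Complex.norm_natCast]
  have hhalf : ∀ p, ‖v * (N p : ℂ)⁻¹‖ ≤ 1 / 2 := fun p => by
    rw [hn]
    exact (mul_le_of_le_one_left (by positivity) hv).trans (h.inv_le_half p)
  refine ⟨∑ p ∈ primesUpTo N z, (Complex.log (1 + v * (N p : ℂ)⁻¹) - v * (N p : ℂ)⁻¹), ?_, ?_⟩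
  · refine (norm_sum_le _ _).trans ?_
    calc _ ≤ ∑ p ∈ primesUpTo N z, ‖v‖ ^ 2 * ((N p : ℝ)⁻¹) ^ 2 := by
          refine Finset.sum_le_sum fun p _ => ?_
          have h1 := hhalf p
          refine (Complex.norm_log_one_add_sub_self_le (by linarith)).trans ?_
          rw [← mul_pow, ← hn, mul_div_assoc]
          refine mul_le_of_le_one_right (by positivity) ?_
          rw [div_le_one two_pos]
          rw [inv_le_comm₀ (by linarith) two_pos]
          linarith
      _ ≤ _ := by
          rw [← Finset.mul_sum]
          nlinarith [h.sum_prime_inv_sq_le (primesUpTo N z), sq_nonneg ‖v‖]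
  · have e : v * (primeSum N z : ℂ) = ∑ p ∈ primesUpTo N z, v * (N p : ℂ)⁻¹ := by
      rw [primeSum, ← Finset.mul_sum]; push_cast; rfl
    rw [e, ← Finset.sum_add_distrib, Complex.exp_sum]
    refine Finset.prod_congr rfl fun p _ => ?_
    rw [add_sub_cancel, Complex.exp_log]
    intro h0
    have h1 := hhalf p
    rw [eq_neg_of_add_eq_zero_right h0] at h1
    norm_num at h1

/-- Truncation lowers `loglog y` only by `log (loglog y)`, which is negligible against the standard
deviation `√(loglog y)`. -/
theorem tendsto_primeSum_truncation (h : LinearGrowth N c C) :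
    Tendsto (fun y : ℝ => (primeSum N (truncation y) - loglog y) / √(loglog y))
      atTop (nhds 0) := by
  have h1 := (h.tendsto_primeSum.comp tendsto_truncation).abs
  have h2 := (tendsto_log_div_sqrt.comp tendsto_loglog).abs
  have h3 := h1.add h2
  simp only [abs_zero, add_zero] at h3
  refine squeeze_zero_norm' ?_ h3
  filter_upwards [tendsto_loglog.eventually_ge_atTop 1, eventually_gt_atTop 1,
    (tendsto_loglog.comp tendsto_truncation).eventually_ge_atTop 1] with y hL hy hz
  simp only [Function.comp] at hz ⊢
  have hl := Real.log_pos hy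
  have e : loglog (truncation y) = loglog y - Real.log (loglog y) := by
    simp only [loglog, truncation] at hL ⊢
    rw [Real.log_exp, Real.log_div (by positivity) (by positivity)]
  have hlog := Real.log_nonneg hL
  change |_ / _| ≤ |(_ - loglog (truncation y)) / √(loglog (truncation y))| + _
  rw [abs_div, abs_div, abs_div, abs_of_nonneg (Real.sqrt_nonneg _),
    abs_of_nonneg (Real.sqrt_nonneg _)]
  have hs : √(loglog (truncation y)) ≤ √(loglog y) := Real.sqrt_le_sqrt (by linarith)
  have hs0 : 0 < √(loglog (truncation y)) := Real.sqrt_pos.2 (by linarith)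
  have e2 : primeSum N (truncation y) - loglog y
      = (primeSum N (truncation y) - loglog (truncation y)) + -Real.log (loglog y) := by
    rw [e]; ring
  rw [e2]
  refine (div_le_div_of_nonneg_right (abs_add_le _ _) (Real.sqrt_nonneg _)).trans ?_
  rw [add_div, abs_neg]
  gcongr

/-- The characteristic function of the normalized number of prime divisors up to the truncation
level. -/
def truncatedCharFun (N : P → ℕ) (t y : ℝ) : ℂ :=
  ((normBall N y).card : ℂ)⁻¹ * ∑ a ∈ normBall N y,
    Complex.exp (Complex.I *
      (t * ((omegaIn (primesUpTo N (truncation y)) a - loglog y) / √(loglog y)) : ℝ))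

theorem tendsto_truncatedCharFun (h : LinearGrowth N c C) {κ D η : ℝ} (hκ : 0 < κ) (hη : 0 < η)
    {l : Filter ℝ} (hl : l ≤ atTop) (hD : ∀ᶠ y in l, SharpCount N κ D η y) (t : ℝ) :
    Tendsto (truncatedCharFun N t) l (nhds (Complex.exp (-(t : ℂ) ^ 2 / 2))) := by
  set σ : ℝ → ℝ := fun y => √(loglog y)
  set S : ℝ → ℝ := fun y => primeSum N (truncation y)
  set w : ℝ → ℂ := fun y => Complex.exp (Complex.I * (t / σ y : ℝ))
  set G : ℝ → ℂ := fun y => ∏ p ∈ primesUpTo N (truncation y), (1 + (w y - 1) * (N p : ℂ)⁻¹)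
  set F : ℝ → ℂ := fun y => ∑ a ∈ normBall N y, w y ^ omegaIn (primesUpTo N (truncation y)) a
  set u : ℝ → ℂ := fun y => Complex.exp (-(Complex.I * (t * σ y : ℝ)))
  have hL : Tendsto loglog l atTop := tendsto_loglog.mono_left hl
  have hσ : Tendsto σ l atTop := Real.tendsto_sqrt_atTop.comp hL
  have hσsq : ∀ᶠ y in l, σ y ^ 2 = loglog y := by
    filter_upwards [hL.eventually_ge_atTop 0] with y hy using Real.sq_sqrt hy
  have hS0 : Tendsto (fun y => (S y - loglog y) / σ y) l (nhds 0) :=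
    h.tendsto_primeSum_truncation.mono_left hl
  have hS : Tendsto (fun y => (S y - σ y ^ 2) / σ y) l (nhds 0) := by
    refine hS0.congr' ?_
    filter_upwards [hσsq] with y hy
    rw [hy]
  have hw : ∀ᶠ y in l, ‖w y - 1‖ ≤ |t| / σ y := by
    filter_upwards [hσ.eventually_gt_atTop 0] with y hy
    have := Real.norm_exp_I_mul_ofReal_sub_one_le (x := t / σ y)
    rwa [Real.norm_eq_abs, abs_div, abs_of_pos hy] at this
  have htσ : Tendsto (fun y => |t| / σ y) l (nhds 0) := hσ.const_div_atTop _
  have hwt : Tendsto (fun y => ‖w y - 1‖) l (nhds 0) :=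
    squeeze_zero' (Eventually.of_forall fun _ => norm_nonneg _) hw htσ
  have hmain : Tendsto (fun y => G y * u y) l (nhds (Complex.exp (-(t : ℂ) ^ 2 / 2))) := by
    choose! ε hε hprod using fun y (hy : ‖w y - 1‖ ≤ 1) => h.exists_prod_eq_exp (truncation y) hy
    have hw1 : ∀ᶠ y in l, ‖w y - 1‖ ≤ 1 := hwt.eventually_le_const one_pos
    have hε0 : Tendsto ε l (nhds 0) := by
      refine squeeze_zero_norm' (hw1.mono fun y hy => hε y hy) ?_
      simpa using (hwt.pow 2).const_mul (4 * C)
    have h1 := (tendsto_exponent t hσ hS).add hε0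
    rw [add_zero] at h1
    refine ((Complex.continuous_exp.tendsto _).comp h1).congr' ?_
    filter_upwards [hw1] with y hy
    simp only [G, u, Function.comp]
    rw [hprod y hy, ← Complex.exp_add]
    congr 1
    ring
  have herr : Tendsto (fun y => (F y - κ * y * G y) / (κ * y)) l (nhds 0) := by
    -- In the exponent, the saving `σ ^ 2 = loglog y` is quadratic in `σ`, while the product over
    -- primes contributes only a linear term in `σ`.
    have hexp : Tendsto (fun y => D / κ * Real.exp (-(σ y * σ y) + Real.exp 1 * |t| *
        ((S y - loglog y) / σ y + σ y))) l (nhds 0) := by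
      have h1 : Tendsto (fun y => -(σ y * (σ y - Real.exp 1 * |t|))
          + Real.exp 1 * |t| * ((S y - loglog y) / σ y)) l atBot :=
        (tendsto_neg_atTop_atBot.comp
          (hσ.atTop_mul_atTop₀ (tendsto_atTop_add_const_right _ _ hσ))).atBot_add
          (hS0.const_mul _)
      have h2 := (Real.tendsto_exp_atBot.comp h1).const_mul (D / κ)
      rw [mul_zero] at h2
      refine h2.congr fun y => ?_
      simp only [Function.comp]
      congr 2
      ring
    refine squeeze_zero_norm' ?_ hexp
    have hη' : ∀ᶠ y in l, (Real.log (truncation y))⁻¹ ≤ η :=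
      (tendsto_inv_atTop_zero.comp (Real.tendsto_log_atTop.comp
        (tendsto_truncation.mono_left hl))).eventually_le_const hη
    filter_upwards [hD, hw, hη', hσsq, hσ.eventually_gt_atTop 0,
      (tendsto_truncation.mono_left hl).eventually_gt_atTop 1, hl (eventually_gt_atTop 1)]
      with y hDy hwy hηy hsq hσy hz hy
    have hy0 : 0 < y := by linarith
    have hlz := Real.log_pos hz
    have hb := h.norm_sum_pow_omegaIn_sub_le hy0.le hDy (inv_nonneg.2 hlz.le) hηy
      (primesUpTo N (truncation y)) (w y)
    have hDnn : 0 ≤ D := by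
      have := (abs_nonneg _).trans (hDy 0 0 le_rfl hη.le)
      rw [elementNorm_zero] at this
      simp only [Nat.cast_one, div_one, sub_zero, Real.rpow_one] at this
      exact nonneg_of_mul_nonneg_left this hy0
    have hb2 := hb.trans (mul_le_mul_of_nonneg_left
      (h.prod_one_add_le hz (norm_nonneg (w y - 1))) (by positivity))
    rw [norm_div, norm_mul, Complex.norm_real, Complex.norm_real, Real.norm_eq_abs,
      Real.norm_eq_abs, abs_of_pos hκ, abs_of_pos hy0, div_le_iff₀ (by positivity)]
    refine hb2.trans ?_
    -- Since `log (truncation y) = log y / loglog y`, the saving is `exp (-loglog y)`.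
    have e1 : y ^ (1 - (Real.log (truncation y))⁻¹) = y * Real.exp (-(σ y * σ y)) := by
      rw [sub_eq_add_neg, Real.rpow_add hy0, Real.rpow_one, Real.rpow_def_of_pos hy0]
      congr 2
      rw [← sq, hsq, truncation, Real.log_exp]
      have := Real.log_pos hy
      field_simp
    have e2 : Real.exp 1 * ‖w y - 1‖ * primeSum N (truncation y)
        ≤ Real.exp 1 * |t| * ((S y - loglog y) / σ y + σ y) := by
      have h1 : (S y - loglog y) / σ y + σ y = S y / σ y := by
        rw [← hsq]; field_simp; ring
      rw [h1]
      have : Real.exp 1 * ‖w y - 1‖ * S y ≤ Real.exp 1 * (|t| / σ y) * S y := by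
        have := primeSum_nonneg N (truncation y)
        gcongr
      refine this.trans_eq ?_
      ring
    rw [e1, Real.exp_add]
    calc _ ≤ D * (y * Real.exp (-(σ y * σ y))) *
        Real.exp (Real.exp 1 * |t| * ((S y - loglog y) / σ y + σ y)) := by gcongr
      _ = _ := by field_simp
  have hratio : Tendsto (fun y => ((normBall N y).card : ℂ) / (κ * y)) l (nhds 1) := by
    rw [tendsto_iff_norm_sub_tendsto_zero]
    have h1 : Tendsto (fun y : ℝ => D / κ * y ^ (-η)) l (nhds 0) := by
      simpa using ((tendsto_rpow_neg_atTop hη).mono_left hl).const_mul (D / κ)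
    refine squeeze_zero' (Eventually.of_forall fun _ => norm_nonneg _) ?_ h1
    filter_upwards [hD, hl (eventually_gt_atTop 1)] with y hDy hy
    have hy0 : 0 < y := by linarith
    have h2 := hDy 0 η hη.le le_rfl
    rw [elementNorm_zero, Nat.cast_one, div_one, sub_eq_add_neg 1 η, Real.rpow_add hy0,
      Real.rpow_one] at h2
    have e : ((normBall N y).card : ℂ) / (κ * y) - 1
        = ((((normBall N y).card : ℝ) - κ * y) / (κ * y) : ℝ) := by
      have h3 : (κ : ℂ) ≠ 0 := by exact_mod_cast hκ.ne'
      have h4 : (y : ℂ) ≠ 0 := by exact_mod_cast hy0.ne'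
      push_cast
      field_simp
    rw [e, Complex.norm_real, Real.norm_eq_abs, abs_div, abs_of_pos (a := κ * y) (by positivity),
      div_le_iff₀ (by positivity)]
    refine h2.trans_eq ?_
    field_simp
  have hu : ∀ y, ‖u y‖ = 1 := fun y => by
    simp only [u]
    rw [← mul_neg, ← Complex.ofReal_neg, mul_comm, Complex.norm_exp_ofReal_mul_I]
  have herru : Tendsto (fun y => (F y - κ * y * G y) / (κ * y) * u y) l (nhds 0) := by
    rw [tendsto_zero_iff_norm_tendsto_zero] at herr ⊢
    simpa only [norm_mul, hu, mul_one] using herr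
  have hfin := (hmain.add herru).div hratio one_ne_zero
  rw [add_zero, div_one] at hfin
  refine hfin.congr' ?_
  filter_upwards [hl (eventually_gt_atTop 1), hσsq, hσ.eventually_gt_atTop 0] with y hy hsq hσy
  have hy0 : (y : ℂ) ≠ 0 := by exact_mod_cast (by linarith : y ≠ 0)
  have hκ0 : (κ : ℂ) ≠ 0 := by exact_mod_cast hκ.ne'
  have hA : ((normBall N y).card : ℂ) ≠ 0 := by exact_mod_cast (h.card_pos hy.le).ne'
  have e : ∑ a ∈ normBall N y, Complex.exp (Complex.I *
      (t * ((omegaIn (primesUpTo N (truncation y)) a - loglog y) / √(loglog y)) : ℝ))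
      = F y * u y := by
    simp only [F, Finset.sum_mul]
    refine Finset.sum_congr rfl fun a _ => ?_
    simp only [w, u]
    rw [← Complex.exp_nat_mul, ← Complex.exp_add]
    congr 1
    have h1 : (σ y : ℂ) ≠ 0 := by exact_mod_cast hσy.ne'
    change Complex.I * ((t * ((_ - loglog y) / σ y) : ℝ) : ℂ) = _
    rw [← hsq]
    push_cast
    field_simp
    ring
  simp only [Pi.div_apply, truncatedCharFun]
  rw [e]
  field_simp
  ring

end LinearGrowth
/-! ### From the truncated prime divisor function to general additive functions -/

/-- The sum of the multiplicities that are at least two. -/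
def excess (a : FreeAbMonoid P) : ℕ := ∑ p ∈ a.support, if 2 ≤ a p then a p else 0

theorem norm_exp_I_sub_exp_I_le (u v : ℝ) :
    ‖Complex.exp (Complex.I * u) - Complex.exp (Complex.I * v)‖ ≤ |u - v| := by
  have e : Complex.exp (Complex.I * u) - Complex.exp (Complex.I * v)
      = Complex.exp (v * Complex.I) * (Complex.exp (Complex.I * (u - v : ℝ)) - 1) := by
    rw [mul_sub, ← Complex.exp_add, mul_one]
    congr 2 <;> push_cast <;> ring
  rw [e, norm_mul, Complex.norm_exp_ofReal_mul_I, one_mul]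
  exact Real.norm_exp_I_mul_ofReal_sub_one_le

/-- A bad element costs at most 2, the trivial bound for two points of the unit circle; for the
others `u ↦ exp (i u)` is 1-Lipschitz. -/
theorem norm_sum_exp_sub_sum_exp_le {α : Type*} (U : Finset α) (bad : α → Prop) [DecidablePred bad]
    (f g e : α → ℝ) (h0 : ∀ a ∈ U, 0 ≤ e a) (h : ∀ a ∈ U, ¬ bad a → |f a - g a| ≤ e a) :
    ‖∑ a ∈ U, Complex.exp (Complex.I * f a) - ∑ a ∈ U, Complex.exp (Complex.I * g a)‖
      ≤ 2 * (U.filter bad).card + ∑ a ∈ U, e a := by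
  rw [← Finset.sum_sub_distrib]
  refine (norm_sum_le _ _).trans ?_
  have e1 : (2 : ℝ) * (U.filter bad).card = ∑ a ∈ U, if bad a then (2 : ℝ) else 0 := by
    rw [← Finset.sum_filter, Finset.sum_const, nsmul_eq_mul, mul_comm]
  rw [e1, ← Finset.sum_add_distrib]
  refine Finset.sum_le_sum fun a ha => ?_
  have h1 := h0 a ha
  split_ifs with hb
  · refine (norm_sub_le _ _).trans ?_
    rw [mul_comm, Complex.norm_exp_ofReal_mul_I, mul_comm, Complex.norm_exp_ofReal_mul_I]
    linarith
  · rw [zero_add]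
    exact (norm_exp_I_sub_exp_I_le _ _).trans (h a ha hb)

/-- To be used with `L = loglog y`, `L'` the double logarithm attached to a single element, and `ω₀`
the truncation of `ω`. The bound is linear in `ω`, `ω₀` and `e`, so it can be averaged over a ball.
-/
theorem abs_normalized_sub_le {L L' B g ω ω₀ e : ℝ} (hB : 0 ≤ B) (hL : 1 ≤ L) (hLB : 4 * B ≤ L)
    (hLL : |L' - L| ≤ B) (hg : |g - ω| ≤ B + B * e) (he : 0 ≤ e) (hω : 0 ≤ ω) (h0 : ω₀ ≤ ω) :
    |(g - L') / √L' - (ω₀ - L) / √L|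
      ≤ (2 * B * ((ω + 2 * B + B * e + L) / L) + (ω - ω₀) + 2 * B + B * e) / √L := by
  have h1 := abs_le.1 hLL
  have h2 := abs_le.1 hg
  have hL' : L / 4 ≤ L' := by linarith
  have hs : 0 < √L := Real.sqrt_pos.2 (by linarith)
  have hs' : √L / 2 ≤ √L' := by
    refine Real.le_sqrt_of_sq_le ?_
    rw [div_pow, Real.sq_sqrt (by linarith)]
    linarith
  have hs'0 : 0 < √L' := by linarith
  have hsq : √L ^ 2 = L := Real.sq_sqrt (by linarith)
  have hsq' : √L' ^ 2 = L' := Real.sq_sqrt (by linarith)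
  -- The first summand is the change of the denominator, the second the change of the numerator.
  have e1 : (g - L') / √L' - (ω₀ - L) / √L
      = ((g - L') * ((√L - √L') / √L') + (g - ω₀ - (L' - L))) / √L := by
    field_simp
    ring
  have hq : |(√L - √L') / √L'| ≤ 2 * B / L := by
    rw [abs_div, abs_of_pos hs'0, div_le_div_iff₀ hs'0 (by linarith)]
    have h3 : |√L - √L'| * (√L + √L') ≤ B := by
      have : |√L - √L'| * (√L + √L') = |L' - L| := by
        rw [← abs_of_pos (a := √L + √L') (by linarith), ← abs_mul, abs_sub_comm L' L]
        congr 1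
        nlinarith
      linarith
    have h4 : |√L - √L'| * √L ≤ B := by
      nlinarith [mul_nonneg (abs_nonneg (√L - √L')) hs'0.le]
    calc |√L - √L'| * L = |√L - √L'| * √L * √L := by rw [mul_assoc, ← sq, hsq]
      _ ≤ B * (2 * √L') := by
          apply mul_le_mul h4 (by linarith) hs.le hB
      _ = _ := by ring
  rw [e1, abs_div, abs_of_pos hs]
  refine div_le_div_of_nonneg_right ?_ hs.le
  refine (abs_add_le _ _).trans ?_
  rw [abs_mul]
  have hBe : 0 ≤ B * e := by positivity
  have h5 : |g - L'| ≤ ω + 2 * B + B * e + L := by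
    rw [abs_le]; constructor <;> linarith
  have h6 : |g - L'| * |(√L - √L') / √L'| ≤ 2 * B * ((ω + 2 * B + B * e + L) / L) := by
    refine (mul_le_mul h5 hq (abs_nonneg _) (by linarith)).trans_eq ?_
    ring
  have h7 : |g - ω₀ - (L' - L)| ≤ (ω - ω₀) + 2 * B + B * e := by
    rw [abs_le]; constructor <;> linarith
  linarith

namespace LinearGrowth

variable {N : P → ℕ} {c C : ℝ}

theorem sum_omegaIn_le (h : LinearGrowth N c C) {y : ℝ} (hy : 0 ≤ y) (Q : Finset P) :
    ∑ a ∈ normBall N y, (omegaIn Q a : ℝ) ≤ C * y * ∑ p ∈ Q, (N p : ℝ)⁻¹ := by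
  classical
  simp only [omegaIn, Finset.card_filter]
  push_cast
  rw [Finset.sum_comm, Finset.mul_sum]
  refine Finset.sum_le_sum fun p _ => ?_
  rw [← Finset.sum_filter, Finset.sum_const, nsmul_eq_mul, mul_one]
  have := h.card_filter_le_bound hy (Finsupp.single p 1)
  rw [elementNorm_single, pow_one] at this
  simpa only [Finsupp.single_le_iff, Nat.one_le_iff_ne_zero] using this

theorem support_subset_primesUpTo (h : LinearGrowth N c C) {y : ℝ} {a : FreeAbMonoid P}
    (ha : a ∈ normBall N y) : a.support ⊆ primesUpTo N y := by
  intro p hp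
  rw [h.mem_normBall] at ha
  rw [h.mem_primesUpTo]
  refine le_trans ?_ ha
  exact_mod_cast norm_le_elementNorm h.one_lt (Finsupp.mem_support_iff.1 hp)

theorem card_support_eq (h : LinearGrowth N c C) {y : ℝ} {a : FreeAbMonoid P}
    (ha : a ∈ normBall N y) : a.support.card = omegaIn (primesUpTo N y) a := by
  rw [omegaIn]
  congr 1
  ext p
  rw [Finset.mem_filter, Finsupp.mem_support_iff]
  exact ⟨fun hp => ⟨h.support_subset_primesUpTo ha (Finsupp.mem_support_iff.2 hp), hp⟩, fun hp => hp.2⟩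

theorem sum_card_support_le (h : LinearGrowth N c C) {y : ℝ} (hy : 0 ≤ y) :
    ∑ a ∈ normBall N y, (a.support.card : ℝ) ≤ C * y * primeSum N y := by
  refine le_trans (le_of_eq (Finset.sum_congr rfl fun a ha => ?_)) (h.sum_omegaIn_le hy _)
  rw [h.card_support_eq ha]

theorem omegaIn_le_card_support (Q : Finset P) (a : FreeAbMonoid P) :
    omegaIn Q a ≤ a.support.card :=
  Finset.card_le_card fun p hp => by
    rw [Finset.mem_filter] at hp
    exact Finsupp.mem_support_iff.2 hp.2

/-- The average number of prime divisors of norm between `z` and `y` is governed by the prime sum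
over that range, which is `o(√(loglog y))` at the truncation level. -/
theorem sum_card_support_sub_le (h : LinearGrowth N c C) {y z : ℝ} (hy : 0 ≤ y) (hz : z ≤ y) :
    ∑ a ∈ normBall N y, ((a.support.card : ℝ) - omegaIn (primesUpTo N z) a)
      ≤ C * y * (primeSum N y - primeSum N z) := by
  classical
  have hsub : primesUpTo N z ⊆ primesUpTo N y := by
    intro p hp
    rw [h.mem_primesUpTo] at hp ⊢
    linarith
  have h1 := h.sum_omegaIn_le hy (primesUpTo N y \ primesUpTo N z)
  rw [Finset.sum_sdiff_eq_sub hsub] at h1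
  refine le_trans (le_of_eq (Finset.sum_congr rfl fun a ha => ?_)) h1
  rw [h.card_support_eq ha, sub_eq_iff_eq_add, ← Nat.cast_add]
  congr 1
  simp only [omegaIn, Finset.card_filter]
  exact (Finset.sum_sdiff hsub).symm

/-- A multiplicity `n ≥ 2` is at most `2 * (n - 1)`, twice the number of `j ≥ 2` for which the
`j`-th power of the prime divides `a`. The geometric series over `j` leaves `4 * C * y / N p ^ 2`,
which is summable over primes. -/
theorem sum_excess_le (h : LinearGrowth N c C) {y : ℝ} (hy : 0 ≤ y) :
    ∑ a ∈ normBall N y, (excess a : ℝ) ≤ 16 * C ^ 2 * y := by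
  classical
  have hC := h.const_pos
  set Q := primesUpTo N y
  set J := (normBall N y).sup fun a => a.support.sup a
  have h1 : ∀ a ∈ normBall N y, (excess a : ℝ) ≤
      ∑ p ∈ Q, ∑ j ∈ Finset.Icc 2 J, 2 * if Finsupp.single p j ≤ a then (1 : ℝ) else 0 := by
    intro a ha
    have hsupp := h.support_subset_primesUpTo ha
    rw [excess]
    push_cast
    refine le_trans (Finset.sum_le_sum_of_subset_of_nonneg hsupp fun p _ _ => ?_)
      (Finset.sum_le_sum fun p _ => ?_)
    · split_ifs <;> positivity
    have hap : a p ≤ J := by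
      by_cases h0 : a p = 0
      · omega
      · exact (Finset.le_sup (f := a) (Finsupp.mem_support_iff.2 h0)).trans
          (Finset.le_sup (f := fun a : FreeAbMonoid P => a.support.sup a) ha)
    rw [← Finset.mul_sum, ← Finset.sum_filter, Finset.sum_const, nsmul_eq_mul, mul_one]
    have h2 : (Finset.Icc 2 J).filter (fun j => Finsupp.single p j ≤ a) = Finset.Icc 2 (a p) := by
      ext j
      simp only [Finset.mem_filter, Finset.mem_Icc, Finsupp.single_le_iff]
      omega
    rw [h2, Nat.card_Icc]
    split_ifs with h3
    · have : a p ≤ 2 * (a p + 1 - 2) := by omega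
      exact_mod_cast this
    · positivity
  refine (Finset.sum_le_sum h1).trans ?_
  rw [Finset.sum_comm]
  have h4 : ∀ p ∈ Q, ∑ a ∈ normBall N y, ∑ j ∈ Finset.Icc 2 J,
      2 * (if Finsupp.single p j ≤ a then (1 : ℝ) else 0) ≤ 4 * C * y * ((N p : ℝ)⁻¹) ^ 2 := by
    intro p _
    rw [Finset.sum_comm]
    have h5 : ∀ j ∈ Finset.Icc 2 J, ∑ a ∈ normBall N y,
        2 * (if Finsupp.single p j ≤ a then (1 : ℝ) else 0)
        ≤ 2 * (C * y) * ((N p : ℝ)⁻¹) ^ j := by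
      intro j _
      rw [← Finset.mul_sum, ← Finset.sum_filter, Finset.sum_const, nsmul_eq_mul, mul_one, mul_assoc]
      have := h.card_filter_le_bound hy (Finsupp.single p j)
      rw [elementNorm_single] at this
      push_cast at this
      rw [inv_pow]
      gcongr
    refine (Finset.sum_le_sum h5).trans ?_
    rw [← Finset.mul_sum]
    have hx := h.inv_le_half p
    have hx0 : (0 : ℝ) ≤ (N p : ℝ)⁻¹ := by positivity
    have h6 : ∑ j ∈ Finset.Icc 2 J, ((N p : ℝ)⁻¹) ^ j ≤ ((N p : ℝ)⁻¹) ^ 2 * 2 := by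
      have h7 : ∑ j ∈ Finset.Icc 2 J, ((N p : ℝ)⁻¹) ^ j
          = ((N p : ℝ)⁻¹) ^ 2 * ∑ j ∈ (Finset.Icc 2 J).image (fun j => j - 2), ((N p : ℝ)⁻¹) ^ j := by
        rw [Finset.sum_image, Finset.mul_sum]
        · refine Finset.sum_congr rfl fun j hj => ?_
          rw [Finset.mem_Icc] at hj
          rw [← pow_add]
          congr 1
          omega
        · intro i hi j hj hij
          simp only [Finset.coe_Icc, Set.mem_Icc] at hi hj
          dsimp only at hij
          omega
      rw [h7]
      gcongr
      refine (sum_le_inv_one_sub _ hx0 (by linarith)).trans ?_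
      rw [inv_le_comm₀ (by linarith) two_pos]
      linarith
    calc _ ≤ 2 * (C * y) * (((N p : ℝ)⁻¹) ^ 2 * 2) := by gcongr
      _ = _ := by ring
  refine (Finset.sum_le_sum h4).trans ?_
  rw [← Finset.mul_sum]
  calc _ ≤ 4 * C * y * (4 * C) := by
        gcongr
        exact h.sum_prime_inv_sq_le Q
    _ = _ := by ring

/-- These are the exceptional elements, whose double logarithm need not be close to `loglog y`. -/
theorem card_small_le (h : LinearGrowth N c C) (y : ℝ) :
    (((normBall N y).filter fun a => (elementNorm N a : ℝ) ≤ √y).card : ℝ) ≤ C * √y := by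
  refine le_trans ?_ (h.upper _ (Real.sqrt_nonneg y))
  exact_mod_cast Finset.card_le_card fun a ha => by
    rw [Finset.mem_filter] at ha
    exact h.mem_normBall.2 ha.2

theorem tendsto_sqrt_div (h : LinearGrowth N c C) :
    Tendsto (fun y : ℝ => √y / (normBall N y).card) atTop (nhds 0) := by
  have hc := h.pos
  have h1 : Tendsto (fun y : ℝ => c⁻¹ / √y) atTop (nhds 0) :=
    Real.tendsto_sqrt_atTop.const_div_atTop _
  refine squeeze_zero' (Eventually.of_forall fun y => by positivity) ?_ h1
  filter_upwards [eventually_ge_atTop 1] with y hy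
  have hs : 0 < √y := Real.sqrt_pos.2 (by linarith)
  rw [div_le_div_iff₀ (h.card_pos hy) hs, ← sq, Real.sq_sqrt (by linarith)]
  have := h.lower y hy
  rw [inv_mul_eq_div, le_div_iff₀ hc]
  linarith

/-- In the application `n a` is the norm of `k • a + b` and `g a` the value of the additive function
there. Outside the elements of norm at most `√y`, the two characteristic functions differ by at most
`|t|` times the mean difference of the normalized variables, which tends to zero by the averages of
`ω`, of its tail above the truncation level, and of `excess`. -/
theorem tendsto_charFun_normalized (h : LinearGrowth N c C) {κ D η : ℝ} (hκ : 0 < κ) (hη : 0 < η)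
    {l : Filter ℝ} (hl : l ≤ atTop) (hD : ∀ᶠ y in l, SharpCount N κ D η y)
    {g : FreeAbMonoid P → ℝ} {n : FreeAbMonoid P → ℕ} {B : ℝ} (hB : 0 ≤ B)
    (hg : ∀ a, |g a - a.support.card| ≤ B + B * excess a)
    (hn : ∀ᶠ y : ℝ in atTop, ∀ a, √y < elementNorm N a → (elementNorm N a : ℝ) ≤ y →
      |loglog (n a) - loglog y| ≤ B) (t : ℝ) :
    Tendsto (fun y => ((normBall N y).card : ℂ)⁻¹ * ∑ a ∈ normBall N y,
      Complex.exp (Complex.I * (t * ((g a - loglog (n a)) / √(loglog (n a))) : ℝ)))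
      l (nhds (Complex.exp (-(t : ℂ) ^ 2 / 2))) := by
  have hC := h.const_pos
  have hc := h.pos
  refine (h.tendsto_truncatedCharFun hκ hη hl hD t).congr_dist ?_
  simp only [dist_eq_norm]
  set S : ℝ → ℝ := primeSum N
  set z := truncation
  set err : ℝ → ℝ := fun y => 2 * C * (√y / (normBall N y).card) + |t| / c *
    ((2 * B * (C * (S y / loglog y) + (2 * B * C + 16 * B * C ^ 2) / loglog y + C) + C * (S y - S (z y))
      + 2 * B * C + 16 * B * C ^ 2) / √(loglog y))
  have hs : Tendsto (fun y => √(loglog y)) atTop atTop :=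
    Real.tendsto_sqrt_atTop.comp tendsto_loglog
  have herr : Tendsto err l (nhds 0) := by
    refine Tendsto.mono_left ?_ hl
    have h1 := h.tendsto_primeSum
    have h2 := h.tendsto_primeSum_truncation
    have h3 : Tendsto (fun y => (√(loglog y))⁻¹) atTop (nhds 0) := tendsto_inv_atTop_zero.comp hs
    have h4 : Tendsto (fun y => (loglog y)⁻¹) atTop (nhds 0) :=
      tendsto_inv_atTop_zero.comp tendsto_loglog
    have h5 : Tendsto (fun y => 2 * C * (√y / (normBall N y).card) + |t| / c *
        (2 * B * (C * ((√(loglog y))⁻¹ + (loglog y)⁻¹ * ((S y - loglog y) / √(loglog y)))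
        + (2 * B * C + 16 * B * C ^ 2) * (loglog y)⁻¹ * (√(loglog y))⁻¹ + C * (√(loglog y))⁻¹)
        + C * ((S y - loglog y) / √(loglog y) - (S (z y) - loglog y) / √(loglog y))
        + (2 * B * C + 16 * B * C ^ 2) * (√(loglog y))⁻¹)) atTop
        (nhds (2 * C * 0 + |t| / c * (2 * B * (C * (0 + 0 * 0)
          + (2 * B * C + 16 * B * C ^ 2) * 0 * 0 + C * 0) + C * (0 - 0)
          + (2 * B * C + 16 * B * C ^ 2) * 0))) :=
      (h.tendsto_sqrt_div.const_mul _).add ((((((((h3.add (h4.mul h1)).const_mul C).add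
        ((h4.const_mul _).mul h3)).add (h3.const_mul C)).const_mul (2 * B)).add
        ((h1.sub h2).const_mul C)).add (h3.const_mul _)).const_mul _)
    have e0 : 2 * C * 0 + |t| / c * (2 * B * (C * (0 + 0 * 0)
          + (2 * B * C + 16 * B * C ^ 2) * 0 * 0 + C * 0) + C * (0 - 0)
          + (2 * B * C + 16 * B * C ^ 2) * 0) = 0 := by ring
    rw [e0] at h5
    refine h5.congr' ?_
    filter_upwards [tendsto_loglog.eventually_gt_atTop 0] with y hy
    have : 0 < √(loglog y) := Real.sqrt_pos.2 hy
    simp only [err]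
    field_simp
    ring
  refine squeeze_zero' (Eventually.of_forall fun _ => norm_nonneg _) ?_ herr
  refine hl ?_
  have hzy : ∀ᶠ y in atTop, z y ≤ y := by
    filter_upwards [tendsto_loglog.eventually_ge_atTop 1, eventually_gt_atTop 1] with y h1 h2
    simp only [z, truncation]
    have h3 := Real.log_pos h2
    calc _ ≤ Real.exp (Real.log y) := Real.exp_le_exp.2 (div_le_self h3.le h1)
      _ = y := Real.exp_log (by linarith)
  filter_upwards [hn, tendsto_loglog.eventually_ge_atTop 1,
    tendsto_loglog.eventually_ge_atTop (4 * B), eventually_gt_atTop 1, hzy]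
    with y hny hL1 hLB hy hz
  have hy0 : 0 ≤ y := by linarith
  have hL0 : 0 < loglog y := by linarith
  have hA := h.card_pos hy.le
  have hsL : 0 < √(loglog y) := Real.sqrt_pos.2 hL0
  set e : FreeAbMonoid P → ℝ := fun a => |t| *
    ((2 * B * (((a.support.card : ℝ) + 2 * B + B * excess a + loglog y) / loglog y)
      + ((a.support.card : ℝ) - omegaIn (primesUpTo N (z y)) a) + 2 * B + B * excess a)
        / √(loglog y))
  have hω : ∀ a, ((omegaIn (primesUpTo N (z y)) a : ℕ) : ℝ) ≤ a.support.card := fun a => by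
    exact_mod_cast omegaIn_le_card_support _ a
  have key := norm_sum_exp_sub_sum_exp_le (normBall N y)
    (fun a => (elementNorm N a : ℝ) ≤ √y)
    (fun a => t * ((omegaIn (primesUpTo N (z y)) a - loglog y) / √(loglog y)))
    (fun a => t * ((g a - loglog (n a)) / √(loglog (n a)))) e
    (fun a _ => by
      have := sub_nonneg.2 (hω a)
      positivity)
    (fun a ha hb => by
      rw [h.mem_normBall] at ha
      rw [← mul_sub, abs_mul, abs_sub_comm]
      exact mul_le_mul_of_nonneg_left (abs_normalized_sub_le hB hL1 hLB
        (hny a (not_le.1 hb) ha) (hg a) (by positivity) (by positivity) (hω a)) (abs_nonneg t))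
  have hsum : ∑ a ∈ normBall N y, e a ≤ |t| * (y * ((2 * B * (C * (S y / loglog y) +
      (2 * B * C + 16 * B * C ^ 2) / loglog y + C)
      + C * (S y - S (z y)) + 2 * B * C + 16 * B * C ^ 2) / √(loglog y))) := by
    simp only [e]
    rw [← Finset.mul_sum, ← Finset.sum_div]
    refine mul_le_mul_of_nonneg_left ?_ (abs_nonneg t)
    rw [← mul_div_assoc]
    refine div_le_div_of_nonneg_right ?_ hsL.le
    have s1 := h.sum_card_support_le hy0
    have s2 := h.sum_excess_le hy0
    have s3 := h.sum_card_support_sub_le hy0 hz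
    have s4 := h.upper y hy0
    simp only [Finset.sum_add_distrib, ← Finset.mul_sum, ← Finset.sum_div, Finset.sum_const,
      nsmul_eq_mul]
    have s5 : ((∑ a ∈ normBall N y, (a.support.card : ℝ)) + (normBall N y).card * (2 * B)
        + B * ∑ a ∈ normBall N y, (excess a : ℝ) + (normBall N y).card * loglog y) / loglog y
        ≤ (C * y * S y + C * y * (2 * B) + B * (16 * C ^ 2 * y) + C * y * loglog y)
          / loglog y := by gcongr
    have s6 : (C * y * S y + C * y * (2 * B) + B * (16 * C ^ 2 * y) + C * y * loglog y)
          / loglog y = y * (C * (S y / loglog y) + (2 * B * C + 16 * B * C ^ 2) / loglog y + C) := by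
      field_simp
      ring
    rw [s6] at s5
    have s7 := mul_le_mul_of_nonneg_left s5 (by positivity : 0 ≤ 2 * B)
    have s8 := mul_le_mul_of_nonneg_left s2 hB
    have s9 := mul_le_mul_of_nonneg_right s4 (by positivity : 0 ≤ 2 * B)
    change _ ≤ C * y * (S y - S (z y)) at s3
    have s10 := add_le_add (add_le_add (add_le_add s7 s3) s9) s8
    refine (le_of_eq ?_).trans (s10.trans_eq ?_) <;> ring
  rw [truncatedCharFun, ← mul_sub, norm_mul, norm_inv, Complex.norm_natCast]
  have hsmall := h.card_small_le y
  set W : ℝ := (2 * B * (C * (S y / loglog y) +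
      (2 * B * C + 16 * B * C ^ 2) / loglog y + C)
      + C * (S y - S (z y)) + 2 * B * C + 16 * B * C ^ 2) / √(loglog y) with hW
  have hSnn : 0 ≤ S y := primeSum_nonneg N y
  have hyA : y / (normBall N y).card ≤ c⁻¹ := by
    rw [div_le_iff₀ hA, inv_mul_eq_div, le_div_iff₀ hc]
    linarith [h.lower y hy.le]
  have hW0 : 0 ≤ |t| * (y * W) := le_trans (Finset.sum_nonneg fun a _ => by
      have := sub_nonneg.2 (hω a)
      simp only [e]
      positivity) hsum
  have hW1 : 0 ≤ |t| * W := by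
    have : 0 < y := by linarith
    have e1 : |t| * W = (|t| * (y * W)) / y := by field_simp
    rw [e1]
    positivity
  calc _ ≤ ((normBall N y).card : ℝ)⁻¹ * (2 * (C * √y) + |t| * (y * W)) := by
        gcongr
        exact key.trans (add_le_add (mul_le_mul_of_nonneg_left hsmall two_pos.le) hsum)
    _ = 2 * C * (√y / (normBall N y).card) + (y / (normBall N y).card) * (|t| * W) := by
        field_simp
    _ ≤ 2 * C * (√y / (normBall N y).card) + c⁻¹ * (|t| * W) := by gcongr
    _ = err y := by simp only [err, ← hW]; ring

end LinearGrowth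
/-! ### Convergence of distribution functions -/

section Distribution

open MeasureTheory ProbabilityTheory

variable {α : Type*}

/-- The distribution of `T` under the uniform measure on the finite set `U`. -/
def uniformLaw (U : Finset α) (T : α → ℝ) : Measure ℝ :=
  (U.card : ENNReal)⁻¹ • ∑ a ∈ U, Measure.dirac (T a)

theorem uniformLaw_apply (U : Finset α) (T : α → ℝ) {s : Set ℝ} (hs : MeasurableSet s) :
    open Classical in
    uniformLaw U T s = (U.card : ENNReal)⁻¹ * ((U.filter fun a => T a ∈ s).card : ENNReal) := by
  classical
  simp only [uniformLaw, Measure.smul_apply, Measure.finsetSum_apply, smul_eq_mul]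
  congr 1
  simp [Measure.dirac_apply' _ hs, Set.indicator_apply]

theorem isProbabilityMeasure_uniformLaw {U : Finset α} (hU : U.Nonempty) (T : α → ℝ) :
    IsProbabilityMeasure (uniformLaw U T) := by
  constructor
  rw [uniformLaw_apply _ _ MeasurableSet.univ]
  simp only [Set.mem_univ, Finset.filter_true]
  exact ENNReal.inv_mul_cancel (by simpa using hU.ne_empty) (by simp)

theorem charFun_uniformLaw (U : Finset α) (T : α → ℝ) (t : ℝ) :
    charFun (uniformLaw U T) t
      = (U.card : ℂ)⁻¹ * ∑ a ∈ U, Complex.exp (Complex.I * (t * T a : ℝ)) := by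
  rw [charFun_apply_real, uniformLaw, integral_smul_measure,
    integral_finsetSum_measure fun a _ => integrable_dirac (by simp)]
  simp only [integral_dirac, ENNReal.toReal_inv, ENNReal.toReal_natCast]
  rw [Complex.real_smul]
  push_cast
  congr 1
  refine Finset.sum_congr rfl fun a _ => ?_
  congr 1
  ring

theorem gaussianReal_Iic (x : ℝ) : (gaussianReal 0 1 (Set.Iic x)).toReal = Phi x := by
  rw [gaussianReal_apply_eq_integral _ one_ne_zero, ENNReal.toReal_ofReal
    (setIntegral_nonneg measurableSet_Iic fun u _ => gaussianPDFReal_nonneg _ _ _), Phi,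
    ← integral_const_mul]
  simp [gaussianPDFReal_def]

/-- Lévy's continuity theorem, then the portmanteau theorem for the half-line, whose boundary point
has Gaussian measure zero. -/
theorem tendsto_cdf_of_charFun {U : ℕ → Finset α} (hU : ∀ n, (U n).Nonempty) (T : α → ℝ)
    (h : ∀ t : ℝ, Tendsto (fun n => ((U n).card : ℂ)⁻¹ *
      ∑ a ∈ U n, Complex.exp (Complex.I * (t * T a : ℝ))) atTop
      (nhds (Complex.exp (-(t : ℂ) ^ 2 / 2)))) (x : ℝ) :
    Tendsto (fun n => (((U n).filter fun a => T a ≤ x).card : ℝ) / (U n).card) atTop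
      (nhds (Phi x)) := by
  classical
  set μ : ℕ → ProbabilityMeasure ℝ := fun n =>
    ⟨uniformLaw (U n) T, isProbabilityMeasure_uniformLaw (hU n) T⟩
  set ν : ProbabilityMeasure ℝ := ⟨gaussianReal 0 1, inferInstance⟩
  have hμ : Tendsto μ atTop (nhds ν) := by
    rw [ProbabilityMeasure.tendsto_iff_tendsto_charFun]
    intro t
    have h1 := h t
    have e : charFun (ν : Measure ℝ) t = Complex.exp (-(t : ℂ) ^ 2 / 2) := by
      change charFun (gaussianReal 0 1) t = _
      rw [charFun_gaussianReal]
      congr 1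
      push_cast
      ring
    rw [e]
    refine h1.congr fun n => ?_
    exact (charFun_uniformLaw _ _ _).symm
  have hfr : (ν : Measure ℝ) (frontier (Set.Iic x)) = 0 := by
    rw [frontier_Iic]
    have := nullSingletonClass_gaussianReal (μ := 0) (v := 1) one_ne_zero
    change gaussianReal 0 1 {x} = 0
    exact measure_singleton x
  have h2 := ProbabilityMeasure.tendsto_measure_of_null_frontier_of_tendsto' hμ hfr
  have h3 := (ENNReal.tendsto_toReal (measure_ne_top (ν : Measure ℝ) (Set.Iic x))).comp h2
  rw [show ((ν : Measure ℝ) (Set.Iic x)).toReal = Phi x from gaussianReal_Iic x] at h3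
  refine h3.congr fun n => ?_
  simp only [Function.comp]
  change (uniformLaw (U n) T (Set.Iic x)).toReal = _
  rw [uniformLaw_apply _ _ measurableSet_Iic, ENNReal.toReal_mul, ENNReal.toReal_inv,
    ENNReal.toReal_natCast, ENNReal.toReal_natCast, inv_mul_eq_div]
  simp only [Set.mem_Iic]

end Distribution

namespace LinearGrowth

variable {N : P → ℕ} {c C : ℝ}

theorem normBall_nonempty (h : LinearGrowth N c C) {y : ℝ} (hy : 1 ≤ y) :
    (normBall N y).Nonempty := by
  refine Finset.card_pos.1 ?_
  exact_mod_cast h.card_pos hy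

/-- A function of the ball of radius `y` has a limit as soon as it has one along the norms. -/
theorem tendsto_of_tendsto_norms (h : LinearGrowth N c C) {β : Type*} {F : Finset (FreeAbMonoid P) → β}
    {v : Filter β}
    (hF : Tendsto (fun y => F (normBall N y))
      (atTop ⊓ 𝓟 (Set.range fun m : FreeAbMonoid P => (elementNorm N m : ℝ))) v) :
    Tendsto (fun y => F (normBall N y)) atTop v := by
  -- `M y` is the largest norm not exceeding `y`. Both radii give the same ball, so `c * y ≤ C * M
  -- y` and `M` tends to infinity.
  set M : ℝ → ℝ := fun y => ((normBall N y).sup (elementNorm N) : ℕ)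
  have hC := h.const_pos
  have hball : ∀ y, 1 ≤ y → normBall N (M y) = normBall N y ∧
      M y ∈ Set.range fun m : FreeAbMonoid P => (elementNorm N m : ℝ) := by
    intro y hy
    obtain ⟨m, hm, he⟩ := Finset.exists_mem_eq_sup _ (h.normBall_nonempty hy) (elementNorm N)
    refine ⟨?_, m, by simp only [M]; rw [he]⟩
    ext a
    constructor
    · intro ha
      rw [h.mem_normBall] at ha hm ⊢
      simp only [M] at ha
      rw [he] at ha
      exact ha.trans hm
    · intro ha
      rw [h.mem_normBall]
      simp only [M]
      exact_mod_cast Finset.le_sup (f := elementNorm N) ha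
  have hM : Tendsto M (atTop : Filter ℝ)
      (atTop ⊓ 𝓟 (Set.range fun m : FreeAbMonoid P => (elementNorm N m : ℝ))) := by
    refine tendsto_inf.2 ⟨?_, tendsto_principal.2 ?_⟩
    · have h1 : Tendsto (fun y : ℝ => c / C * y) atTop atTop :=
        tendsto_id.const_mul_atTop (div_pos h.pos hC)
      refine tendsto_atTop_mono' _ ?_ h1
      filter_upwards [eventually_ge_atTop 1] with y hy
      have h2 := h.lower y hy
      rw [← (hball y hy).1] at h2
      have h3 := h2.trans (h.upper (M y) (by simp [M]))
      rw [div_mul_eq_mul_div, div_le_iff₀ hC]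
      linarith
    · filter_upwards [eventually_ge_atTop 1] with y hy using (hball y hy).2
  refine (hF.comp hM).congr' ?_
  filter_upwards [eventually_ge_atTop 1] with y hy
  simp only [Function.comp]
  rw [(hball y hy).1]

theorem tendsto_cdf (h : LinearGrowth N c C) {κ D η : ℝ} (hκ : 0 < κ) (hη : 0 < η)
    (hD : ∀ m : FreeAbMonoid P, SharpCount N κ D η (elementNorm N m))
    {g : FreeAbMonoid P → ℝ} {n : FreeAbMonoid P → ℕ} {B : ℝ} (hB : 0 ≤ B)
    (hg : ∀ a, |g a - a.support.card| ≤ B + B * excess a)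
    (hn : ∀ᶠ y : ℝ in atTop, ∀ a, √y < elementNorm N a → (elementNorm N a : ℝ) ≤ y →
      |loglog (n a) - loglog y| ≤ B) (x : ℝ) :
    Tendsto (fun y => (((normBall N y).filter fun a =>
      (g a - loglog (n a)) / √(loglog (n a)) ≤ x).card : ℝ) / (normBall N y).card) atTop
      (nhds (Phi x)) := by
  refine h.tendsto_of_tendsto_norms (F := fun U => ((U.filter fun a =>
      (g a - loglog (n a)) / √(loglog (n a)) ≤ x).card : ℝ) / U.card) ?_
  refine tendsto_of_seq_tendsto fun u hu => ?_
  set l : Filter ℝ := atTop ⊓ 𝓟 (Set.range fun m : FreeAbMonoid P => (elementNorm N m : ℝ))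
  have hl : l ≤ atTop := inf_le_left
  have hDl : ∀ᶠ y in l, SharpCount N κ D η y := by
    have : ∀ᶠ y in 𝓟 (Set.range fun m : FreeAbMonoid P => (elementNorm N m : ℝ)),
        SharpCount N κ D η y := by
      rw [eventually_principal]
      rintro _ ⟨m, rfl⟩
      exact hD m
    exact this.filter_mono inf_le_right
  have hu1 : ∀ᶠ i in atTop, 1 ≤ u i := (hu.mono_right hl).eventually_ge_atTop 1
  -- The maximum with 1 keeps every ball nonempty; it changes only finitely many terms.
  have key := tendsto_cdf_of_charFun (U := fun i => normBall N (max (u i) 1))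
    (fun i => h.normBall_nonempty (le_max_right _ _))
    (fun a => (g a - loglog (n a)) / √(loglog (n a))) (fun t => by
      refine ((h.tendsto_charFun_normalized hκ hη hl hDl hB hg hn t).comp hu).congr' ?_
      filter_upwards [hu1] with i hi
      simp only [Function.comp]
      rw [max_eq_left hi]) x
  refine key.congr' ?_
  filter_upwards [hu1] with i hi
  simp only [Function.comp]
  rw [max_eq_left hi]

/-- For `y ≥ 9` only elements of norm at most `√y` can violate the extra condition, and their
proportion tends to zero. -/
theorem tendsto_cdf_of_three_le (h : LinearGrowth N c C) {κ D η : ℝ} (hκ : 0 < κ) (hη : 0 < η)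
    (hD : ∀ m : FreeAbMonoid P, SharpCount N κ D η (elementNorm N m))
    {g : FreeAbMonoid P → ℝ} {n : FreeAbMonoid P → ℕ} {B : ℝ} (hB : 0 ≤ B)
    (hg : ∀ a, |g a - a.support.card| ≤ B + B * excess a)
    (hn : ∀ᶠ y : ℝ in atTop, ∀ a, √y < elementNorm N a → (elementNorm N a : ℝ) ≤ y →
      |loglog (n a) - loglog y| ≤ B) (hn' : ∀ a, elementNorm N a ≤ n a) (x : ℝ) :
    Tendsto (fun y => (((normBall N y).filter fun a => 3 ≤ n a ∧
      (g a - loglog (n a)) / √(loglog (n a)) ≤ x).card : ℝ) / (normBall N y).card) atTop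
      (nhds (Phi x)) := by
  refine (h.tendsto_cdf hκ hη hD hB hg hn x).congr_dist ?_
  have h1 := h.tendsto_sqrt_div.const_mul C
  rw [mul_zero] at h1
  refine squeeze_zero' (Eventually.of_forall fun _ => dist_nonneg) ?_ h1
  filter_upwards [eventually_ge_atTop 9] with y hy
  set U := normBall N y
  set T : FreeAbMonoid P → ℝ := fun a => (g a - loglog (n a)) / √(loglog (n a))
  have hA := h.card_pos (by linarith : 1 ≤ y)
  have h3 : 3 ≤ √y := Real.le_sqrt_of_sq_le (by linarith)
  have hle1 : (U.filter fun a => 3 ≤ n a ∧ T a ≤ x).card ≤ (U.filter fun a => T a ≤ x).card :=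
    Finset.card_le_card fun a ha => by
      rw [Finset.mem_filter] at ha ⊢
      exact ⟨ha.1, ha.2.2⟩
  have hle2 : (U.filter fun a => T a ≤ x).card ≤ (U.filter fun a => 3 ≤ n a ∧ T a ≤ x).card
      + (U.filter fun a => (elementNorm N a : ℝ) ≤ √y).card := by
    classical
    refine (Finset.card_le_card fun a ha => ?_).trans (Finset.card_union_le _ _)
    rw [Finset.mem_filter] at ha
    rw [Finset.mem_union, Finset.mem_filter, Finset.mem_filter]
    by_cases hs : (elementNorm N a : ℝ) ≤ √y
    · exact Or.inr ⟨ha.1, hs⟩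
    · refine Or.inl ⟨ha.1, ?_, ha.2⟩
      have h4 : (3 : ℝ) < elementNorm N a := by linarith [not_le.1 hs]
      have h5 : 3 < elementNorm N a := by exact_mod_cast h4
      exact h5.le.trans (hn' a)
  have hle1' : ((U.filter fun a => 3 ≤ n a ∧ T a ≤ x).card : ℝ)
    ≤ (U.filter fun a => T a ≤ x).card := by exact_mod_cast hle1
  have hle2' : ((U.filter fun a => T a ≤ x).card : ℝ) ≤ (U.filter fun a => 3 ≤ n a ∧ T a ≤ x).card
      + (U.filter fun a => (elementNorm N a : ℝ) ≤ √y).card := by exact_mod_cast hle2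
  have hsm := h.card_small_le y
  rw [Real.dist_eq, ← sub_div, abs_div, abs_of_pos hA, mul_div_assoc']
  refine div_le_div_of_nonneg_right ?_ hA.le
  rw [abs_le]
  constructor <;> linarith

end LinearGrowth
/-! ### The decomposition of full elements -/

/-- The elements `b` with all nonzero multiplicities strictly between `k` and `2 * k`. Every `k`-full
element is uniquely of the form `k • a + b` with such a `b`. -/
def residualElements (P : Type*) (k : ℕ) : Set (FreeAbMonoid P) :=
  {b | ∀ p, b p = 0 ∨ k < b p ∧ b p < 2 * k}

/-- The multiplicity in the residual part of a `k`-full element of multiplicity `n`. -/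
def residualMult (k n : ℕ) : ℕ := if n % k = 0 then 0 else k + n % k

/-- The residual part of a `k`-full element. -/
def residualPart (k : ℕ) (m : FreeAbMonoid P) : FreeAbMonoid P :=
  m.mapRange (residualMult k) (by simp [residualMult])

theorem residualMult_cases {k : ℕ} (hk : 1 ≤ k) (n : ℕ) :
    residualMult k n = 0 ∨ k < residualMult k n ∧ residualMult k n < 2 * k := by
  have := Nat.mod_lt n hk
  unfold residualMult
  split_ifs
  · exact Or.inl rfl
  · right; omega

theorem residualPart_mem {k : ℕ} (hk : 1 ≤ k) (m : FreeAbMonoid P) :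
    residualPart k m ∈ residualElements P k := fun p => residualMult_cases hk (m p)

theorem residualPart_smul_add {k : ℕ} {a b : FreeAbMonoid P}
    (hb : b ∈ residualElements P k) : residualPart k (k • a + b) = b := by
  ext p
  simp only [residualPart, Finsupp.mapRange_apply, Finsupp.add_apply, Finsupp.smul_apply,
    smul_eq_mul, residualMult, Nat.mul_add_mod]
  rcases hb p with h | ⟨h1, h2⟩
  · simp [h]
  · have h3 : b p % k = b p - k := by
      rw [Nat.mod_eq_sub_mod h1.le, Nat.mod_eq_of_lt (by omega)]
    rw [h3, if_neg (by omega)]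
    omega

theorem smul_add_mem_fullElements {k : ℕ} (a : FreeAbMonoid P) {b : FreeAbMonoid P}
    (hb : b ∈ residualElements P k) : k • a + b ∈ fullElements P k := by
  intro p hp
  simp only [Finsupp.add_apply, Finsupp.smul_apply, smul_eq_mul] at hp ⊢
  rcases hb p with h | ⟨h1, h2⟩
  · rw [h, add_zero] at hp ⊢
    exact Nat.le_mul_of_pos_right _ (Nat.pos_of_ne_zero fun h0 => by simp [h0] at hp)
  · omega

theorem exists_eq_smul_add_residualPart {k : ℕ} (hk : 1 ≤ k) {m : FreeAbMonoid P}
    (hm : m ∈ fullElements P k) : ∃ a, m = k • a + residualPart k m := by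
  refine ⟨m.mapRange (fun n => (n - residualMult k n) / k) (by simp), ?_⟩
  ext p
  simp only [residualPart, Finsupp.mapRange_apply, Finsupp.add_apply, Finsupp.smul_apply,
    smul_eq_mul, residualMult]
  have h1 := Nat.div_add_mod (m p) k
  have h2 := hm p
  split_ifs with h
  · rw [Nat.sub_zero, add_zero]
    omega
  · have h3 : 1 ≤ m p / k := by
      rw [Nat.one_le_div_iff (by omega)]
      refine h2 (Nat.pos_of_ne_zero fun h0 => ?_)
      rw [h0] at h
      simp at h
    obtain ⟨q, hq⟩ := Nat.exists_eq_add_of_le h3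
    rw [hq] at h1
    have h4 : m p - (k + m p % k) = k * q := by
      have : k * (1 + q) = k + k * q := by ring
      omega
    rw [h4, Nat.mul_div_cancel_left _ (by omega)]
    have : k * (1 + q) = k + k * q := by ring
    omega

theorem smul_add_right_injective {k : ℕ} (hk : 1 ≤ k) (b : FreeAbMonoid P) :
    Function.Injective fun a : FreeAbMonoid P => k • a + b := by
  intro a a' h
  have h1 : k • a = k • a' := add_right_cancel h
  ext p
  have h2 := DFunLike.congr_fun h1 p
  simp only [Finsupp.smul_apply, smul_eq_mul] at h2
  exact Nat.eq_of_mul_eq_mul_left hk h2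

/-- The finite set of `k`-full elements of norm at most `x`. -/
def fullBall (N : P → ℕ) (k : ℕ) (x : ℝ) : Finset (FreeAbMonoid P) :=
  open Classical in (normBall N x).filter (· ∈ fullElements P k)

/-- The radius of the ball of those `a` for which `k • a + b` has norm at most `x`. -/
def fiberRadius (N : P → ℕ) (k : ℕ) (b : FreeAbMonoid P) (x : ℝ) : ℝ :=
  (x / elementNorm N b) ^ (k : ℝ)⁻¹

theorem tendsto_fiberRadius {N : P → ℕ} (hN : ∀ p, 1 < N p) {k : ℕ} (hk : 1 ≤ k)
    (b : FreeAbMonoid P) : Tendsto (fiberRadius N k b) atTop atTop := by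
  have hb : (0 : ℝ) < elementNorm N b := by exact_mod_cast elementNorm_pos hN b
  exact (tendsto_rpow_atTop (by positivity)).comp (tendsto_id.atTop_div_const hb)

namespace LinearGrowth

variable {N : P → ℕ} {c C : ℝ}

/-- The sum runs over the fibres of `residualPart`; on the fibre of `b` the condition `N a ^ k * N b
≤ x` describes a ball in `a`. -/
theorem card_filter_fullBall (h : LinearGrowth N c C) {k : ℕ} (hk : 1 ≤ k) {x : ℝ} (hx : 0 ≤ x)
    (p : FreeAbMonoid P → Prop) :
    open Classical in
    ((fullBall N k x).filter p).card = ∑ b ∈ (normBall N x).filter (· ∈ residualElements P k),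
      ((normBall N (fiberRadius N k b x)).filter fun a => p (k • a + b)).card := by
  classical
  rw [Finset.card_eq_sum_card_fiberwise (f := residualPart k)
    (t := (normBall N x).filter (· ∈ residualElements P k))]
  · refine Finset.sum_congr rfl fun b hb => ?_
    rw [Finset.mem_filter] at hb
    have hb0 : (0 : ℝ) < elementNorm N b := by exact_mod_cast elementNorm_pos h.one_lt b
    have hnorm : ∀ a : FreeAbMonoid P,
        k • a + b ∈ normBall N x ↔ a ∈ normBall N (fiberRadius N k b x) := by
      intro a
      rw [h.mem_normBall, h.mem_normBall, fiberRadius, Real.le_rpow_inv_iff_of_pos (by positivity)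
        (by positivity) (by positivity), elementNorm_add, elementNorm_smul, le_div_iff₀ hb0,
        Real.rpow_natCast]
      push_cast
      rfl
    rw [← Finset.card_image_of_injective ((normBall N (fiberRadius N k b x)).filter fun a =>
      p (k • a + b)) (smul_add_right_injective hk b)]
    refine congrArg Finset.card ?_
    ext m
    simp only [Finset.mem_filter, Finset.mem_image, fullBall]
    constructor
    · rintro ⟨⟨⟨h1, h2⟩, h3⟩, h4⟩
      obtain ⟨a, ha⟩ := exists_eq_smul_add_residualPart hk h2
      rw [h4] at ha
      subst ha
      exact ⟨a, ⟨(hnorm a).1 h1, h3⟩, rfl⟩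
    · rintro ⟨a, ⟨h1, h2⟩, rfl⟩
      exact ⟨⟨⟨(hnorm a).2 h1, smul_add_mem_fullElements a hb.2⟩, h2⟩,
        residualPart_smul_add hb.2⟩
  · intro m hm
    simp only [Finset.coe_filter, Set.mem_ofPred_eq, fullBall, Finset.mem_filter] at hm ⊢
    refine ⟨?_, residualPart_mem hk m⟩
    obtain ⟨a, ha⟩ := exists_eq_smul_add_residualPart hk hm.1.2
    rw [h.mem_normBall] at hm ⊢
    refine le_trans ?_ hm.1.1
    exact_mod_cast elementNorm_le_of_le h.one_lt (by
      conv_rhs => rw [ha]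
      exact le_add_self)

theorem card_fullBall (h : LinearGrowth N c C) {k : ℕ} (hk : 1 ≤ k) {x : ℝ} (hx : 0 ≤ x) :
    open Classical in
    (fullBall N k x).card = ∑ b ∈ (normBall N x).filter (· ∈ residualElements P k),
      (normBall N (fiberRadius N k b x)).card := by
  classical
  simpa using h.card_filter_fullBall hk hx fun _ => True

/-- The fibre over `b = 0`, that is the `k`-th powers, already has this size. -/
theorem card_fullBall_ge (h : LinearGrowth N c C) {k : ℕ} (hk : 1 ≤ k) {x : ℝ} (hx : 1 ≤ x) :
    c * x ^ (k : ℝ)⁻¹ ≤ (fullBall N k x).card := by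
  classical
  have h0 : (0 : FreeAbMonoid P) ∈ (normBall N x).filter (· ∈ residualElements P k) := by
    rw [Finset.mem_filter, h.mem_normBall, elementNorm_zero]
    exact ⟨by exact_mod_cast hx, fun p => Or.inl rfl⟩
  rw [h.card_fullBall hk (by linarith)]
  have h1 := Finset.single_le_sum (f := fun b => (normBall N (fiberRadius N k b x)).card)
    (fun _ _ => Nat.zero_le _) h0
  have h2 := h.lower (x ^ (k : ℝ)⁻¹) (Real.one_le_rpow hx (by positivity))
  refine h2.trans ?_
  refine le_trans (le_of_eq ?_) (Nat.cast_le.2 h1)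
  simp [fiberRadius, elementNorm_zero]

/-- Residual multiplicities are at least `k + 1`, so the Euler factor is at most `1 + k * N p ^ (-(1
+ 1 / k))` and the product over primes converges. -/
theorem summable_residual (h : LinearGrowth N c C) {k : ℕ} (hk : 1 ≤ k) :
    Summable ((residualElements P k).indicator fun b : FreeAbMonoid P =>
      (elementNorm N b : ℝ) ^ (-(k : ℝ)⁻¹)) := by
  classical
  refine summable_of_sum_le (c := Real.exp (k * (4 * C / (k : ℝ)⁻¹)))
    (fun b => Set.indicator_nonneg (fun _ _ => by positivity) _) fun F => ?_
  set F' := F.filter (· ∈ residualElements P k)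
  have e1 : ∑ b ∈ F, (residualElements P k).indicator
      (fun b : FreeAbMonoid P => (elementNorm N b : ℝ) ^ (-(k : ℝ)⁻¹)) b
      = ∑ b ∈ F', b.prod fun p n => ((N p : ℝ) ^ (-(k : ℝ)⁻¹)) ^ n := by
    rw [Finset.sum_filter]
    refine Finset.sum_congr rfl fun b _ => ?_
    rw [Set.indicator_apply, elementNorm_rpow_eq_prod]
  rw [e1]
  set Q := F'.biUnion Finsupp.support
  refine (sum_prod_le_prod_sum Q (insert 0 (Finset.Ioo k (2 * k))) _ (fun _ _ => by positivity)
    (fun _ => pow_zero _) F' fun b hb => ⟨Finset.subset_biUnion_of_mem Finsupp.support hb,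
      fun p _ => ?_⟩).trans ?_
  · rw [Finset.mem_insert, Finset.mem_Ioo]
    exact (Finset.mem_filter.1 hb).2 p
  calc _ ≤ ∏ p ∈ Q, Real.exp (k * (N p : ℝ) ^ (-(1 + (k : ℝ)⁻¹))) := by
        refine Finset.prod_le_prod (fun p _ => Finset.sum_nonneg fun _ _ => by positivity)
          fun p _ => ?_
        refine le_trans ?_ (Real.add_one_le_exp _)
        rw [Finset.sum_insert (by simp), pow_zero, add_comm]
        gcongr
        have hp := h.two_le p
        have h1 : ∀ j ∈ Finset.Ioo k (2 * k), ((N p : ℝ) ^ (-(k : ℝ)⁻¹)) ^ j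
            ≤ (N p : ℝ) ^ (-(1 + (k : ℝ)⁻¹)) := by
          intro j hj
          rw [Finset.mem_Ioo] at hj
          rw [← Real.rpow_natCast, ← Real.rpow_mul (by positivity)]
          refine Real.rpow_le_rpow_of_exponent_le (by linarith) ?_
          have hk0 : (0 : ℝ) < k := by exact_mod_cast hk
          have hj1 : (k : ℝ) + 1 ≤ j := by exact_mod_cast hj.1
          have e2 : 1 + (k : ℝ)⁻¹ = (k : ℝ)⁻¹ * (k + 1) := by field_simp
          rw [e2, neg_mul, neg_le_neg_iff]
          gcongr
        refine (Finset.sum_le_card_nsmul _ _ _ h1).trans ?_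
        rw [nsmul_eq_mul, Nat.card_Ioo]
        gcongr
        omega
    _ = Real.exp (k * ∑ p ∈ Q, (N p : ℝ) ^ (-(1 + (k : ℝ)⁻¹))) := by
        rw [Finset.mul_sum, Real.exp_sum]
    _ ≤ _ := by
        refine Real.exp_le_exp.2 ?_
        gcongr
        exact h.sum_prime_rpow_le (by positivity)
          (inv_le_one_of_one_le₀ (by exact_mod_cast hk)) Q

/-- If a property has limiting density `φ` on each fibre of the decomposition of the `k`-full
elements, then it has limiting density `φ` on the `k`-full elements. -/
theorem tendsto_density_fullBall (h : LinearGrowth N c C) {k : ℕ} (hk : 1 ≤ k)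
    (p : FreeAbMonoid P → Prop) (φ : ℝ)
    (hp : ∀ b ∈ residualElements P k, open Classical in
      Tendsto (fun y => (((normBall N y).filter fun a => p (k • a + b)).card : ℝ)
        / (normBall N y).card) atTop (nhds φ)) :
    open Classical in
    Tendsto (fun x => (((fullBall N k x).filter p).card : ℝ) / (fullBall N k x).card) atTop
      (nhds φ) := by
  classical
  have hc := h.pos
  have hC := h.const_pos
  set R := residualElements P k
  set A : FreeAbMonoid P → ℝ → ℝ := fun b x => (normBall N (fiberRadius N k b x)).card
  set E : FreeAbMonoid P → ℝ → ℝ := fun b x =>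
    ((normBall N (fiberRadius N k b x)).filter fun a => p (k • a + b)).card
  set V : ℝ → ℝ := fun x => (fullBall N k x).card
  set f : ℝ → FreeAbMonoid P → ℝ := fun x => R.indicator fun b => (E b x - φ * A b x) / V x
  have hV : ∀ x, 1 ≤ x → 0 < V x := fun x hx =>
    lt_of_lt_of_le (by positivity) (h.card_fullBall_ge hk hx)
  -- The share of a fibre among all `k`-full elements is bounded uniformly in `x` by a summable
  -- function of the residual part, as dominated convergence requires.
  have hAV : ∀ x, 1 ≤ x → ∀ b, A b x / V x ≤ C / c * (elementNorm N b : ℝ) ^ (-(k : ℝ)⁻¹) := by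
    intro x hx b
    have h1 := h.card_fullBall_ge hk hx
    have h2 : A b x ≤ C * fiberRadius N k b x :=
      h.upper _ (Real.rpow_nonneg (by positivity) _)
    have hb : (0 : ℝ) < elementNorm N b := by exact_mod_cast elementNorm_pos h.one_lt b
    rw [fiberRadius, Real.div_rpow (by linarith) hb.le, div_eq_mul_inv _ (_ ^ _),
      ← Real.rpow_neg hb.le] at h2
    rw [div_le_iff₀ (hV x hx)]
    refine h2.trans ?_
    calc _ = C / c * (elementNorm N b : ℝ) ^ (-(k : ℝ)⁻¹) * (c * x ^ (k : ℝ)⁻¹) := by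
          field_simp
      _ ≤ _ := by gcongr
  have hE : ∀ b x, E b x ≤ A b x := fun b x => by
    simp only [E, A]
    exact_mod_cast Finset.card_filter_le _ _
  have hlim : Tendsto (fun x => ∑' b, f x b) atTop (nhds (∑' _ : FreeAbMonoid P, (0 : ℝ))) := by
    refine tendsto_tsum_of_dominated_convergence
      (bound := fun b => (1 + |φ|) * (C / c) * R.indicator
        (fun b : FreeAbMonoid P => (elementNorm N b : ℝ) ^ (-(k : ℝ)⁻¹)) b)
      ((h.summable_residual hk).mul_left _) ?_ ?_
    · intro b
      by_cases hb : b ∈ R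
      · have h1 := ((hp b hb).comp (tendsto_fiberRadius h.one_lt hk b)).sub_const φ
        rw [sub_self] at h1
        have h2 := h1.abs.const_mul (C / c * (elementNorm N b : ℝ) ^ (-(k : ℝ)⁻¹))
        rw [abs_zero, mul_zero] at h2
        refine squeeze_zero_norm' ?_ h2
        filter_upwards [eventually_ge_atTop 1,
          (tendsto_fiberRadius h.one_lt hk b).eventually_ge_atTop 1] with x hx hx'
        simp only [f, Set.indicator_of_mem hb, Function.comp]
        have hA : 0 < A b x := h.card_pos hx'
        have e : (E b x - φ * A b x) / V x = A b x / V x * (E b x / A b x - φ) := by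
          field_simp
        rw [e, norm_mul, Real.norm_eq_abs, Real.norm_eq_abs,
          abs_of_nonneg (div_nonneg hA.le (hV x hx).le)]
        exact mul_le_mul_of_nonneg_right (hAV x hx b) (abs_nonneg _)
      · simp only [f, Set.indicator_of_notMem hb]
        exact tendsto_const_nhds
    · filter_upwards [eventually_ge_atTop 1] with x hx b
      by_cases hb : b ∈ R
      · simp only [f, Set.indicator_of_mem hb]
        have hA : 0 ≤ A b x := by positivity
        have hE0 : 0 ≤ E b x := by positivity
        have h1 : |E b x - φ * A b x| ≤ (1 + |φ|) * A b x := by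
          refine (abs_sub _ _).trans ?_
          rw [abs_mul, abs_of_nonneg hA, abs_of_nonneg hE0]
          linarith [hE b x]
        rw [Real.norm_eq_abs, abs_div, abs_of_pos (hV x hx), mul_assoc]
        refine (div_le_div_of_nonneg_right h1 (hV x hx).le).trans ?_
        rw [mul_div_assoc]
        exact mul_le_mul_of_nonneg_left (hAV x hx b) (by positivity)
      · simp only [f, Set.indicator_of_notMem hb]
        simp
  rw [tsum_zero] at hlim
  have h3 := hlim.add_const φ
  rw [zero_add] at h3
  refine h3.congr' ?_
  filter_upwards [eventually_ge_atTop 1] with x hx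
  have hx0 : 0 < x := by linarith
  -- For `N b > x` the fibre radius is below 1 and the fibre is empty.
  have h4 : ∑' b, f x b = ∑ b ∈ (normBall N x).filter (· ∈ R), (E b x - φ * A b x) / V x := by
    rw [tsum_eq_sum (s := (normBall N x).filter (· ∈ R))]
    · refine Finset.sum_congr rfl fun b hb => ?_
      exact Set.indicator_of_mem (Finset.mem_filter.1 hb).2 _
    · intro b hb
      by_cases hbR : b ∈ R
      · rw [Finset.mem_filter, not_and, h.mem_normBall] at hb
        have h5 : x < elementNorm N b := by
          by_contra h6
          exact hb (not_lt.1 h6) hbR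
        have h7 : normBall N (fiberRadius N k b x) = ∅ := by
          rw [Finset.eq_empty_iff_forall_notMem]
          intro a ha
          rw [h.mem_normBall] at ha
          have h8 := (one_le_elementNorm h.one_lt a).trans ha
          have h9 : fiberRadius N k b x < 1 :=
            Real.rpow_lt_one (by positivity) (by rw [div_lt_one (by linarith)]; exact h5)
              (by positivity)
          linarith
        simp only [f, Set.indicator_of_mem hbR, E, A, h7]
        simp
      · exact Set.indicator_of_notMem hbR _
  have h10 : (((fullBall N k x).filter p).card : ℝ)
      = ∑ b ∈ (normBall N x).filter (· ∈ R), E b x := by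
    rw [h.card_filter_fullBall hk hx0.le]
    push_cast
    rfl
  have h11 : V x = ∑ b ∈ (normBall N x).filter (· ∈ R), A b x := by
    simp only [V]
    rw [h.card_fullBall hk hx0.le]
    push_cast
    rfl
  rw [h4, ← Finset.sum_div, Finset.sum_sub_distrib, ← Finset.mul_sum, ← h11, ← h10]
  have := (hV x hx).ne'
  change _ = _ / V x
  field_simp
  ring

end LinearGrowth
/-! ### Additive functions on full elements -/

/-- At a prime outside `b`, multiplicity one in `a` contributes `f k - 1 = 0`, and a higher
multiplicity is paid for by `excess`. The primes of `b` add a quantity independent of `a`, apart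
from what `excess` absorbs. -/
theorem abs_sum_smul_add_sub_card_support_le {k : ℕ} (hk : 1 ≤ k) {f : ℕ → ℝ} {D : ℝ} (hf0 : f 0 = 0)
    (hfk : f k = 1) (hD : ∀ n, |f n| ≤ D * n) (a b : FreeAbMonoid P) :
    |∑ p ∈ (k • a + b).support, f ((k • a + b) p) - a.support.card|
      ≤ ∑ p ∈ b.support, (D * k + D * b p + 1) + (D * k + 1) * excess a := by
  classical
  have hk0 : (0 : ℝ) < k := by exact_mod_cast hk
  have hD0 : 0 < D := by
    have := hD k
    rw [hfk, abs_one] at this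
    by_contra h
    nlinarith
  set S := a.support ∪ b.support
  have hsub : (k • a + b).support ⊆ S := by
    intro p hp
    rw [Finset.mem_union, Finsupp.mem_support_iff, Finsupp.mem_support_iff]
    rw [Finsupp.mem_support_iff, Finsupp.add_apply, Finsupp.smul_apply, smul_eq_mul] at hp
    by_contra! h
    simp [h.1, h.2] at hp
  have e1 : ∑ p ∈ (k • a + b).support, f ((k • a + b) p) = ∑ p ∈ S, f (k * a p + b p) := by
    rw [Finset.sum_subset hsub fun p _ hp => by rw [Finsupp.notMem_support_iff.1 hp, hf0]]
    rfl
  have e2 : (a.support.card : ℝ) = ∑ p ∈ S, if a p ≠ 0 then (1 : ℝ) else 0 := by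
    rw [Finset.card_eq_sum_ones]
    push_cast
    rw [Finset.sum_ite, Finset.sum_const_zero, add_zero]
    refine Finset.sum_congr ?_ fun _ _ => rfl
    ext p
    simp only [S, Finset.mem_filter, Finset.mem_union, Finsupp.mem_support_iff]
    tauto
  have e3 : (excess a : ℝ) = ∑ p ∈ S, if 2 ≤ a p then (a p : ℝ) else 0 := by
    rw [excess]
    push_cast
    refine Finset.sum_subset Finset.subset_union_left fun p _ hp => ?_
    rw [Finsupp.notMem_support_iff.1 hp]
    simp
  have e4 : ∑ p ∈ b.support, (D * k + D * b p + 1)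
      = ∑ p ∈ S, if b p ≠ 0 then D * k + D * b p + 1 else 0 := by
    rw [← Finset.sum_subset Finset.subset_union_right (fun p _ hp => by
      rw [Finsupp.notMem_support_iff.1 hp]; simp)]
    refine Finset.sum_congr rfl fun p hp => ?_
    rw [if_pos (Finsupp.mem_support_iff.1 hp)]
  rw [e1, e2, e3, e4, ← Finset.sum_sub_distrib, Finset.mul_sum, ← Finset.sum_add_distrib]
  refine (Finset.abs_sum_le_sum_abs _ _).trans (Finset.sum_le_sum fun p _ => ?_)
  have hfb := hD (k * a p + b p)
  push_cast at hfb
  have hind : |if a p ≠ 0 then (1 : ℝ) else 0| ≤ 1 := by split_ifs <;> simp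
  have htri := (abs_sub (f (k * a p + b p)) (if a p ≠ 0 then (1 : ℝ) else 0)).trans
    (add_le_add hfb hind)
  have hDk : 0 < D * k := by positivity
  by_cases hb : b p = 0
  · rw [hb] at htri ⊢
    rw [if_neg (c := (0 : ℕ) ≠ 0) (by simp), zero_add]
    rcases Nat.lt_or_ge (a p) 2 with h | h
    · rw [if_neg (c := 2 ≤ a p) (by omega)]
      interval_cases a p
      · simp [hf0]
      · simp [hfk]
    · rw [if_pos (c := 2 ≤ a p) h]
      have h1 : (1 : ℝ) ≤ a p := by exact_mod_cast (by omega : 1 ≤ a p)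
      push_cast at htri
      linarith
  · rw [if_pos hb]
    have h0 : (0 : ℝ) ≤ a p := by positivity
    split_ifs at htri ⊢ with h1 h2 h2
    · nlinarith
    · have h3 : a p = 1 := by omega
      rw [h3] at htri ⊢
      push_cast at htri
      linarith
    · omega
    · have h3 : a p = 0 := by omega
      rw [h3] at htri ⊢
      push_cast at htri
      linarith

namespace LinearGrowth

variable {N : P → ℕ} {c C : ℝ}

/-- The logarithm of the norm is `k * log (N a) + log (N b)`, which lies between `log y / 2` and a
constant multiple of `log y`; a second logarithm makes this an additive error. -/
theorem eventually_abs_loglog_sub_le (h : LinearGrowth N c C) {k : ℕ} (hk : 1 ≤ k)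
    (b : FreeAbMonoid P) : ∃ B : ℝ, 0 ≤ B ∧ ∀ᶠ y : ℝ in atTop, ∀ a, √y < elementNorm N a →
      (elementNorm N a : ℝ) ≤ y → |loglog (elementNorm N (k • a + b)) - loglog y| ≤ B := by
  have hk1 : (1 : ℝ) ≤ k := by exact_mod_cast hk
  have hb1 := one_le_elementNorm h.one_lt b
  have hlb : 0 ≤ Real.log (elementNorm N b) := Real.log_nonneg hb1
  have hKpos : 0 ≤ Real.log (k + Real.log (elementNorm N b)) := Real.log_nonneg (by linarith)
  refine ⟨Real.log 2 + Real.log (k + Real.log (elementNorm N b)), by positivity, ?_⟩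
  filter_upwards [eventually_gt_atTop 1, Real.tendsto_log_atTop.eventually_ge_atTop 1]
    with y hy hly a ha1 ha2
  have hy0 : 0 < y := by linarith
  have ha0 : (0 : ℝ) < elementNorm N a := (Real.sqrt_nonneg y).trans_lt ha1
  have e : Real.log (elementNorm N (k • a + b))
      = k * Real.log (elementNorm N a) + Real.log (elementNorm N b) := by
    rw [elementNorm_add, elementNorm_smul]
    push_cast
    rw [Real.log_mul (by positivity) (by positivity), Real.log_pow]
  have h1 : Real.log y / 2 ≤ Real.log (elementNorm N a) := by
    rw [← Real.log_sqrt hy0.le]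
    exact Real.log_le_log (Real.sqrt_pos.2 hy0) ha1.le
  have h2 : Real.log (elementNorm N a) ≤ Real.log y := Real.log_le_log ha0 ha2
  have h3 : Real.log y / 2 ≤ Real.log (elementNorm N (k • a + b)) := by
    rw [e]; nlinarith
  have h4 : Real.log (elementNorm N (k • a + b))
      ≤ (k + Real.log (elementNorm N b)) * Real.log y := by
    rw [e]; nlinarith
  have h5 := Real.log_le_log (by linarith) h3
  have h6 := Real.log_le_log (by linarith) h4
  rw [Real.log_div (by linarith) two_ne_zero] at h5
  rw [Real.log_mul (by linarith) (by linarith)] at h6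
  have hl2 : 0 ≤ Real.log 2 := Real.log_nonneg (by norm_num)
  simp only [loglog]
  rw [abs_le]
  constructor <;> linarith

/-- The Erdős–Kac law for additive functions whose value at a prime power depends only on the
exponent, grows at most linearly, and is one for the exponent `k`. -/
theorem erdosKacLaw (h : LinearGrowth N c C) {κ D η : ℝ} (hκ : 0 < κ) (hη : 0 < η)
    (hD : ∀ m : FreeAbMonoid P, SharpCount N κ D η (elementNorm N m)) (X : Set ℚ) {k : ℕ}
    (hk : 1 ≤ k) {f : ℕ → ℝ} {K : ℝ} (hf0 : f 0 = 0) (hfk : f k = 1) (hK : ∀ n, |f n| ≤ K * n)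
    {g : FreeAbMonoid P → ℝ} (hg : ∀ m, g m = ∑ p ∈ m.support, f (m p)) :
    ErdosKacLaw N X (fullElements P k) g := by
  classical
  intro x
  have key := h.tendsto_density_fullBall hk (fun m => 3 ≤ elementNorm N m ∧
    (g m - loglog (elementNorm N m)) / √(loglog (elementNorm N m)) ≤ x) (Phi x) fun b _ => by
      obtain ⟨B₁, hB₁, hn⟩ := h.eventually_abs_loglog_sub_le hk b
      have hK0 : 0 ≤ K := by
        have := hK 1
        simp only [Nat.cast_one, mul_one] at this
        exact (abs_nonneg _).trans this
      have hB₂ : 0 ≤ ∑ p ∈ b.support, (K * k + K * b p + 1) :=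
        Finset.sum_nonneg fun _ _ => by positivity
      have hB₃ : 0 ≤ K * k + 1 := by positivity
      set B := B₁ + ∑ p ∈ b.support, (K * k + K * b p + 1) + (K * k + 1) with hB
      refine Tendsto.congr (fun y => by congr!) (h.tendsto_cdf_of_three_le
        (g := fun a => g (k • a + b)) (n := fun a => elementNorm N (k • a + b)) (B := B)
        hκ hη hD (by positivity) ?_ ?_ ?_ x)
      · intro a
        rw [hg]
        refine (abs_sum_smul_add_sub_card_support_le hk hf0 hfk hK a b).trans ?_
        have : K * k + 1 ≤ B := by linarith
        gcongr
        linarith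
      · filter_upwards [hn] with y hy a h1 h2
        exact (hy a h1 h2).trans (by linarith)
      · intro a
        refine elementNorm_le_of_le h.one_lt (le_add_right ?_)
        rw [Finsupp.le_def]
        intro p
        simp only [Finsupp.smul_apply, smul_eq_mul]
        exact Nat.le_mul_of_pos_left _ hk
  have hcast : Tendsto (fun q : ℚ => (q : ℝ)) (atTopIn X) atTop :=
    tendsto_ratCast_atTop_iff.2 (tendsto_id.mono_left inf_le_left)
  refine (key.comp hcast).congr fun q => ?_
  have hmem : ∀ m, m ∈ fullBall N k (q : ℝ) ↔ m ∈ upTo N (fullElements P k) q := by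
    intro m
    rw [fullBall, Finset.mem_filter, h.mem_normBall]
    simp only [upTo, Set.mem_ofPred_eq]
    rw [and_comm]
    refine and_congr_right fun _ => ?_
    exact_mod_cast Iff.rfl
  simp only [Function.comp]
  rw [← Set.ncard_coe_finset, ← Set.ncard_coe_finset]
  congr 3
  · ext m
    simp only [Finset.coe_filter, Set.mem_ofPred_eq, hmem]
  · ext m
    rw [Finset.mem_coe, hmem]

end LinearGrowth

/-! ### The three functions as sums over prime elements -/

theorem bigOmega_div_eq (k : ℕ) (m : FreeAbMonoid P) :
    1 / (k : ℝ) * (bigOmega m : ℝ) = ∑ p ∈ m.support, (m p : ℝ) / k := by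
  rw [bigOmega, ← Finset.sum_div]
  push_cast
  ring

theorem numDivisors_eq (m : FreeAbMonoid P) : numDivisors m = ∏ p ∈ m.support, (m p + 1) := by
  classical
  have : {d : FreeAbMonoid P | ∀ p, d p ≤ m p} = ↑(Finset.Iic m) := by
    ext d
    simp [Finsupp.le_def]
  rw [numDivisors, this, Set.ncard_coe_finset, Finsupp.card_Iic]
  simp

theorem log_numDivisors_div_eq (k : ℕ) (m : FreeAbMonoid P) :
    1 / Real.log ((k : ℝ) + 1) * Real.log (numDivisors m)
      = ∑ p ∈ m.support, Real.log (m p + 1) / Real.log ((k : ℝ) + 1) := by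
  rw [numDivisors_eq, ← Finset.sum_div]
  push_cast
  rw [Real.log_prod fun p _ => by positivity]
  ring

/-- The value of `omegaT` at a prime power, in terms of the exponent. -/
def signMult (n : ℕ) : ℝ := if n = 0 then 0 else if Odd n then 1 else -1

theorem omegaT_eq (m : FreeAbMonoid P) : (omegaT m : ℝ) = ∑ p ∈ m.support, signMult (m p) := by
  rw [omegaT, Finset.card_filter, Finset.card_filter]
  push_cast
  rw [← Finset.sum_sub_distrib]
  refine Finset.sum_congr rfl fun p hp => ?_
  rw [signMult, if_neg (Finsupp.mem_support_iff.1 hp)]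
  by_cases h : Odd (m p)
  · simp [h]
  · simp [h, Nat.not_odd_iff_even.1 h]

theorem abs_signMult_le (n : ℕ) : |signMult n| ≤ n := by
  unfold signMult
  rcases Nat.eq_zero_or_pos n with rfl | hn
  · simp
  · have : (1 : ℝ) ≤ n := by exact_mod_cast hn
    rw [if_neg hn.ne']
    split_ifs <;> simpa using this

theorem neg_one_pow_mul_signMult {k : ℕ} (hk : 1 ≤ k) : (-1 : ℝ) ^ (k - 1) * signMult k = 1 := by
  obtain ⟨j, rfl⟩ := Nat.exists_eq_add_of_le hk
  unfold signMult
  rw [if_neg (by omega), Nat.add_sub_cancel_left]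
  rcases Nat.even_or_odd j with h | h
  · rw [if_pos (by rw [add_comm]; exact h.add_one), h.neg_one_pow, one_mul]
  · rw [if_neg (by rw [add_comm, Nat.not_odd_iff_even]; exact h.add_one), h.neg_one_pow]
    norm_num

/-! ### Counting from the asymptotic condition -/

/-- `X` may be as sparse as the powers of one integer. It contains all powers of some `q > 1`, and
monotonicity between consecutive powers gives two-sided linear bounds at every real radius, with a
loss of a factor `q`. The sharp count holds with `η = 1 - θ`, since a quotient of two norms lies in
`X`. -/
theorem exists_linearGrowth {N : P → ℕ} (hN : ∀ p, 1 < N p) {X : Set ℚ} (hX : IsNormRange N X)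
    (hstar : ConditionStar N X) (hne : (atTopIn X).NeBot) :
    ∃ c C κ D η : ℝ, LinearGrowth N c C ∧ 0 < κ ∧ 0 < η ∧
      ∀ m : FreeAbMonoid P, SharpCount N κ D η (elementNorm N m) := by
  obtain ⟨hfin, κ, θ, hκ, hθ0, hθ1, hO⟩ := hstar
  have hcast : Tendsto (fun q : ℚ => (q : ℝ)) (atTopIn X) atTop :=
    tendsto_ratCast_atTop_iff.2 (tendsto_id.mono_left inf_le_left)
  have hset : ∀ q : ℚ, upTo N Set.univ q = {m | (elementNorm N m : ℝ) ≤ q} := by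
    intro q
    ext m
    simp only [upTo, Set.mem_univ, true_and, Set.mem_ofPred_eq]
    exact_mod_cast Iff.rfl
  have hfinite : ∀ u : ℝ, {m : FreeAbMonoid P | (elementNorm N m : ℝ) ≤ u}.Finite := by
    intro u
    obtain ⟨q, hq1, hq2⟩ := (hfin.and (hcast.eventually_ge_atTop u)).exists
    rw [hset] at hq1
    exact hq1.subset fun m hm => le_trans hm hq2
  set A : ℝ → ℝ := fun u => ((normBall N u).card : ℝ) with hA
  have hmem : ∀ {u : ℝ} {m : FreeAbMonoid P}, m ∈ normBall N u ↔ (elementNorm N m : ℝ) ≤ u := by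
    intro u m
    unfold normBall
    rw [dif_pos (hfinite u)]
    simp
  have hcount : ∀ q : ℚ, ((upTo N Set.univ q).ncard : ℝ) = A q := by
    intro q
    rw [hset, Set.ncard_eq_toFinset_card _ (hfinite q)]
    simp only [A]
    unfold normBall
    rw [dif_pos (hfinite q)]
  have hmono : ∀ {u v : ℝ}, u ≤ v → A u ≤ A v := by
    intro u v huv
    simp only [A]
    exact_mod_cast Finset.card_le_card fun m hm => hmem.2 ((hmem.1 hm).trans huv)
  have hA0 : ∀ {u : ℝ}, u < 1 → A u = 0 := by
    intro u hu
    simp only [A]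
    rw [Nat.cast_eq_zero, Finset.card_eq_zero, Finset.eq_empty_iff_forall_notMem]
    intro m hm
    linarith [hmem.1 hm, one_le_elementNorm hN m]
  have hA1 : ∀ {u : ℝ}, 1 ≤ u → 1 ≤ A u := by
    intro u hu
    have : 0 < (normBall N u).card :=
      Finset.card_pos.2 ⟨0, hmem.2 (by rw [elementNorm_zero]; exact_mod_cast hu)⟩
    simp only [A]
    exact_mod_cast this
  obtain ⟨C₀, hC₀⟩ := hO.bound
  rw [atTopIn, eventually_inf_principal, eventually_atTop] at hC₀
  obtain ⟨x₀, hx₀⟩ := hC₀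
  set E : ℝ := |(A x₀)| + κ * |(x₀ : ℝ)|
  have hE : 0 ≤ E := by positivity
  set D : ℝ := κ + |C₀| + E
  have hD : 0 < D := by positivity
  -- The asymptotic is extended to all positive points of `X`: below 1 the count is zero and `κ * q
  -- ≤ κ * q ^ e`; between 1 and `x₀` everything is at most `E`; beyond `x₀` the hypothesis applies.
  have hbound : ∀ q ∈ X, 0 < q → ∀ e : ℝ, θ ≤ e → e ≤ 1 →
      |A q - κ * (q : ℝ)| ≤ D * (q : ℝ) ^ e := by
    intro q hqX hq e he1 he2
    have hq0 : (0 : ℝ) < q := by exact_mod_cast hq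
    have hpow : 0 < (q : ℝ) ^ e := by positivity
    rcases lt_or_ge (q : ℝ) 1 with h1 | h1
    · rw [hA0 h1, zero_sub, abs_neg, abs_of_pos (by positivity)]
      have h2 : (q : ℝ) ≤ (q : ℝ) ^ e := by
        conv_lhs => rw [← Real.rpow_one (q : ℝ)]
        exact Real.rpow_le_rpow_of_exponent_ge hq0 h1.le he2
      have h3 : κ ≤ D := by simp only [D]; linarith [abs_nonneg C₀]
      gcongr
    · rcases le_total x₀ q with h2 | h2
      · have h3 := hx₀ q h2 hqX
        rw [hcount, Real.norm_eq_abs, Real.norm_eq_abs,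
          abs_of_pos (Real.rpow_pos_of_pos hq0 θ)] at h3
        have h4 : (q : ℝ) ^ θ ≤ (q : ℝ) ^ e := Real.rpow_le_rpow_of_exponent_le h1 he1
        have h5 : C₀ ≤ D := by simp only [D]; linarith [le_abs_self C₀]
        exact h3.trans (mul_le_mul h5 h4 (by positivity) hD.le)
      · have h2' : (q : ℝ) ≤ x₀ := by exact_mod_cast h2
        have h3 : |A q - κ * (q : ℝ)| ≤ E := by
          refine (abs_sub _ _).trans ?_
          rw [abs_of_nonneg (by positivity : 0 ≤ A q), abs_of_pos (by positivity : 0 < κ * (q : ℝ))]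
          have h4 := (hmono h2').trans (le_abs_self _)
          have h5 := mul_le_mul_of_nonneg_left (h2'.trans (le_abs_self _)) hκ.le
          exact add_le_add h4 h5
        have h4 : E ≤ D := by simp only [D]; linarith [abs_nonneg C₀]
        have h5 : 1 ≤ (q : ℝ) ^ e := Real.one_le_rpow h1 (by linarith)
        nlinarith
  have hone : (1 : ℚ) ∈ X := by simpa [elementNorm_zero] using hX.1 0
  have hevX : ∀ᶠ q in atTopIn X, q ∈ X := by
    rw [atTopIn, eventually_inf_principal]
    exact Eventually.of_forall fun _ h => h
  obtain ⟨q, hq1, hqX⟩ := ((hcast.eventually_gt_atTop 1).and hevX).exists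
  have hq1' : (1 : ℚ) < q := by exact_mod_cast hq1
  -- Products come from quotients: `q ^ (n + 1) = q ^ n / (1 / q)`.
  have hqpow : ∀ n : ℕ, q ^ n ∈ X := by
    intro n
    induction n with
    | zero => simpa using hone
    | succ n ih =>
      have h1 : (1 : ℚ) / q ∈ X := hX.2 1 hone q hqX (by positivity)
      have h2 := hX.2 _ ih _ h1 (by positivity)
      rwa [div_div_eq_mul_div, div_one, ← pow_succ] at h2
  have hq0 : (0 : ℝ) < q := by linarith
  have hpowbound : ∀ n : ℕ, ∀ e : ℝ, θ ≤ e → e ≤ 1 →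
      |A ((q : ℝ) ^ n) - κ * (q : ℝ) ^ n| ≤ D * ((q : ℝ) ^ n) ^ e := by
    intro n e he1 he2
    have := hbound (q ^ n) (hqpow n) (by positivity) e he1 he2
    push_cast at this
    exact this
  obtain ⟨v₀, hv₀⟩ : ∃ v₀ : ℝ, ∀ v ≥ v₀, D * v ^ θ ≤ κ / 2 * v := by
    have h1 : Tendsto (fun v : ℝ => v ^ (-(1 - θ))) atTop (nhds 0) :=
      tendsto_rpow_neg_atTop (by linarith)
    have h2 : ∀ᶠ v : ℝ in atTop, v ^ (-(1 - θ)) ≤ κ / 2 / D :=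
      h1.eventually_le_const (by positivity)
    obtain ⟨v₀, hv₀⟩ := eventually_atTop.1 (h2.and (eventually_gt_atTop 0))
    refine ⟨v₀, fun v hv => ?_⟩
    obtain ⟨h3, h4⟩ := hv₀ v hv
    rw [le_div_iff₀ hD] at h3
    have h5 : v ^ θ = v ^ (-(1 - θ)) * v := by
      conv_rhs => rw [← Real.rpow_one v, ← Real.rpow_mul h4.le, one_mul, ← Real.rpow_add h4]
      ring_nf
    rw [h5]
    nlinarith
  set v₁ := max v₀ 1
  have hv₁ : 1 ≤ v₁ := le_max_right _ _
  -- In the lower constant, the first entry serves powers of `q` beyond `v₁`, where the error is at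
  -- most half the main term; the second serves smaller ones, where only `A u ≥ 1` is used.
  refine ⟨min (κ / (2 * q)) (1 / (q * v₁)), (κ + D) * q, κ, D, 1 - θ, ?_, hκ, by linarith, ?_⟩
  · refine ⟨hN, hfinite, lt_min (by positivity) (by positivity), fun u hu => ?_, fun u hu => ?_⟩
    · obtain ⟨n, hn1, hn2⟩ := exists_nat_pow_near hu hq1
      change _ ≤ A u
      rw [pow_succ] at hn2
      rcases le_total v₁ ((q : ℝ) ^ n) with h1 | h1
      · have h2 := hv₀ _ ((le_max_left _ _).trans h1)
        have h3 := (abs_le.1 (hpowbound n θ le_rfl hθ1.le)).1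
        have h4 := hmono hn1
        have h5 : κ / 2 * (q : ℝ) ^ n ≤ A u := by linarith
        refine le_trans ?_ h5
        calc _ ≤ κ / (2 * q) * u := by
              gcongr
              exact min_le_left _ _
          _ ≤ κ / (2 * q) * ((q : ℝ) ^ n * q) := by gcongr
          _ = _ := by field_simp
      · refine le_trans ?_ (hA1 hu)
        calc _ ≤ 1 / (q * v₁) * u := by
              gcongr
              exact min_le_right _ _
          _ ≤ 1 / (q * v₁) * (v₁ * q) := by
              gcongr
              exact hn2.le.trans (by gcongr)
          _ = 1 := by field_simp
    · change A u ≤ _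
      rcases lt_or_ge u 1 with h1 | h1
      · rw [hA0 h1]
        positivity
      · obtain ⟨n, hn1, hn2⟩ := exists_nat_pow_near h1 hq1
        have h3 := (abs_le.1 (hpowbound (n + 1) 1 hθ1.le le_rfl)).2
        rw [Real.rpow_one] at h3
        have h4 := hmono hn2.le
        rw [pow_succ] at h3 h4
        have h5 : (κ + D) * ((q : ℝ) ^ n * q) ≤ (κ + D) * (u * q) := by gcongr
        linarith
  · intro m d δ hδ0 hδ1
    have hd : (0 : ℚ) < elementNorm N d := by exact_mod_cast elementNorm_pos hN d
    have hm : (0 : ℚ) < elementNorm N m := by exact_mod_cast elementNorm_pos hN m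
    have := hbound _ (hX.2 _ (hX.1 m) _ (hX.1 d) hd.ne') (by positivity) (1 - δ) (by linarith)
      (by linarith)
    push_cast at this
    exact this

end ErdosKacMonoid

end

theorem mainTheorem9 {P : Type*} [Countable P] (N : P → ℕ) (hN : ∀ p, 1 < N p) (X : Set ℚ)
    (hX : ErdosKacMonoid.IsNormRange N X) (hstar : ErdosKacMonoid.ConditionStar N X)
    (k : ℕ) (hk : 1 ≤ k) :
    ErdosKacMonoid.ErdosKacLaw N X (ErdosKacMonoid.fullElements P k)
        (fun m => 1 / (k : ℝ) * (ErdosKacMonoid.bigOmega m : ℝ)) ∧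
      ErdosKacMonoid.ErdosKacLaw N X (ErdosKacMonoid.fullElements P k)
        (fun m => 1 / Real.log ((k : ℝ) + 1) * Real.log (ErdosKacMonoid.numDivisors m : ℝ)) ∧
      ErdosKacMonoid.ErdosKacLaw N X (ErdosKacMonoid.fullElements P k)
        (fun m => (-1 : ℝ) ^ (k - 1) * (ErdosKacMonoid.omegaT m : ℝ)) := by
  open ErdosKacMonoid in
  -- The filter is trivial when `X` is bounded above, which can happen only if there are no prime
  -- elements; every limit then holds vacuously.
  rcases (atTopIn X).eq_or_neBot with hbot | hne
  · refine ⟨?_, ?_, ?_⟩ <;>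
    · intro a
      rw [hbot]
      exact tendsto_bot
  obtain ⟨c, C, κ, D, η, h, hκ, hη, hD⟩ := exists_linearGrowth hN hX hstar hne
  have hk1 : (1 : ℝ) ≤ k := by exact_mod_cast hk
  have hlog2 : (1 : ℝ) / 2 ≤ Real.log 2 := by linarith [Real.log_two_gt_d9]
  have hlogk : (1 : ℝ) / 2 ≤ Real.log ((k : ℝ) + 1) :=
    hlog2.trans (Real.log_le_log two_pos (by linarith))
  refine ⟨?_, ?_, ?_⟩
  · refine h.erdosKacLaw hκ hη hD X hk (f := fun n => (n : ℝ) / k) (K := 1) (by simp)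
      (div_self (by positivity)) (fun n => ?_) (bigOmega_div_eq k)
    rw [abs_of_nonneg (by positivity), one_mul]
    exact div_le_self (by positivity) hk1
  · refine h.erdosKacLaw hκ hη hD X hk
      (f := fun n => Real.log (n + 1) / Real.log ((k : ℝ) + 1)) (K := 2) (by simp)
      (div_self (by linarith)) (fun n => ?_) (log_numDivisors_div_eq k)
    have h1 : 0 ≤ Real.log ((n : ℝ) + 1) := Real.log_nonneg (by linarith [n.cast_nonneg (α := ℝ)])
    have h2 := Real.log_le_sub_one_of_pos (by positivity : (0 : ℝ) < n + 1)
    rw [abs_of_nonneg (div_nonneg h1 (by linarith)), div_le_iff₀ (by linarith)]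
    nlinarith [n.cast_nonneg (α := ℝ)]
  · refine h.erdosKacLaw hκ hη hD X hk (f := fun n => (-1 : ℝ) ^ (k - 1) * signMult n) (K := 1)
      (by simp [signMult]) (neg_one_pow_mul_signMult hk) (fun n => ?_) fun m => ?_
    · rw [abs_mul, abs_pow, abs_neg, abs_one, one_pow]
      simpa using abs_signMult_le n
    · rw [omegaT_eq, Finset.mul_sum]
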